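/- **Setting.** There are $m$ resources, and an agent's pure strategies form a finite set $\mathcal S$ of subsets of $\{1,\dots,m\}$, identified with their $0/1$ vectors in $\mathbb R^m$ and not all empty; $\mathcal X=\mathrm{conv}(\mathcal S)$. Let $n\ge 1$ (the number of agents), $c_{\max}>0$ and $\vartheta\ge 1$. Let $b_1,\dots,b_s\in\mathcal S$ be linearly independent strategies forming a $\vartheta$-barycentric spanner: every $x\in\mathcal X$ equals $\sum_k a_k b_k$ with $|a_k|\le\vartheta$ for all $k$. Let $B$ be the matrix with columns $b_1,\dots,b_s$, $\bar b=\frac1s\sum_k b_k$, $\mathcal D=\{a\in[-\vartheta,\vartheta]^s: Ba\in\mathcal X\}$ and $\mathcal D^\mu=(1-\mu)\mathcal D+\frac{\mu}{s}\mathbf 1$. For $t\ge1$ put $$\mu_t=\min\Big\{\frac{n^{1/5}}{m^{7/5}t^{1/5}c_{\max}^{1/5}},\ \frac12\Big\},\qquad \gamma_t=\sqrt{\frac{c_{\max}\,\mu_t}{\vartheta\, n^3m^6\,t}}.$$ **Algorithm (BGD-CE).** Start from an arbitrary $\alpha^1\in\mathcal D^{\mu_1}$. In round $t=1,\dots,T$,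 put $x^t=B\alpha^t$, write $(x^t-\mu_t\bar b)/(1-\mu_t)\in\mathcal X$ as a convex combination $\sum_{j=1}^{m+1}\lambda_jv_j$ of pure strategies, and let $\pi^t$ be the mixed strategy that draws $v_j$ with probability $(1-\mu_t)\lambda_j$ and $b_k$ with probability $\mu_t/s$ (adding up the probabilities of equal strategies). Sample $p^t\sim\pi^t$ (conditionally on the past and on $c^t$), suffer and observe the cost $l^t=\langle c^t,p^t\rangle$, put $\hat c^t=l^t M_t^+p^t$, where $M_t=\mathbb E_{v\sim\pi^t}[vv^\top]$ and $M_t^+$ is its pseudoinverse, and let $\alpha^{t+1}$ be the Euclidean projection of $\alpha^t-\gamma_tB^\top\hat c^t$ onto $\mathcal D^{\mu_{t+1}}$. The adversary is adaptive: $c^t\in\mathbb R^m$ with $\|c^t\|_\infty\le c_{\max}$ (in particular $c^t\in[0,c_{\max}]^m$) may depend on everything that happened before $p^t$ is sampled. **Theorem.** For every $\vartheta\ge1$ there are constants $K>0$ and $r\in\mathbb N$, depending on $\vartheta$ only, such that in the above setting, for all $n,m,\mathcal S$, all $\vartheta$-spanners, all $c_{\max}>0$, $T\ge 1$, $\delta\in(0,1)$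 and every adaptive adversary, with probability at least $1-\delta$, $$\sum_{t=1}^T\langle c^t,p^t\rangle-\min_{u\in\mathcal S}\sum_{t=1}^T\langle c^t,u\rangle\ \le\ K\,n^{7/10}\,m^{5.5}\max\{1,c_{\max}\}^2\,T^{4/5}\,(1+\log T)^r\sqrt{1+\log\tfrac1\delta}.$$ -/

import Mathlib

open MeasureTheory ProbabilityTheory

namespace BGDCE

/-- The `0/1` vector of a pure strategy, i.e. of a set of resources. -/
def strategyVec {m : ℕ} (p : Finset (Fin m)) : Fin m → ℝ :=
  fun e => if e ∈ p then 1 else 0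

/-- The implicit description polytope: the convex hull of the pure strategies. -/
def descriptionPolytope {m : ℕ} (S : Finset (Finset (Fin m))) : Set (Fin m → ℝ) :=
  convexHull ℝ (strategyVec '' (S : Set (Finset (Fin m))))

/-- The matrix whose columns are the strategies `b 0, …, b (s - 1)`. -/
def spannerMatrix {m s : ℕ} (b : Fin s → Finset (Fin m)) : Matrix (Fin m) (Fin s) ℝ :=
  Matrix.of fun e k => strategyVec (b k) e

/-- `b` is a `θ`-barycentric spanner, made of pure strategies, of the description polytope. -/
structure IsSpanner {m s : ℕ} (S : Finset (Finset (Fin m))) (θ : ℝ)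
    (b : Fin s → Finset (Fin m)) : Prop where
  mem : ∀ k, b k ∈ S
  linearIndependent : LinearIndependent ℝ (fun k => strategyVec (b k))
  span : ∀ x ∈ descriptionPolytope S,
    ∃ a : Fin s → ℝ, x = ∑ k, a k • strategyVec (b k) ∧ ∀ k, a k ^ 2 ≤ θ ^ 2

/-- The basis polytope. -/
def basisPolytope {m s : ℕ} (S : Finset (Finset (Fin m))) (θ : ℝ)
    (b : Fin s → Finset (Fin m)) : Set (Fin s → ℝ) :=
  {a | (∀ k, a k ∈ Set.Icc (-θ) θ) ∧ (spannerMatrix b).mulVec a ∈ descriptionPolytope S}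

/-- The `μ`-bounded-away basis polytope `(1 - μ) D + (μ / s) 𝟙`. -/
def boundedAwayPolytope {m s : ℕ} (S : Finset (Finset (Fin m))) (θ : ℝ)
    (b : Fin s → Finset (Fin m)) (μ : ℝ) : Set (Fin s → ℝ) :=
  (fun z => (1 - μ) • z + fun _ => μ / (s : ℝ)) '' basisPolytope S θ b

/-- `a` is a Euclidean projection of `y` onto the set `D`. -/
def IsProjection {s : ℕ} (D : Set (Fin s → ℝ)) (y a : Fin s → ℝ) : Prop :=
  a ∈ D ∧ ∀ z ∈ D, ∑ k, (y k - a k) ^ 2 ≤ ∑ k, (y k - z k) ^ 2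

/-- `(v, w)` is a Caratheodory decomposition of `x`: a convex combination of `m + 1` (not
necessarily distinct) strategies of `S`, with weights `w`, that equals `x`. -/
structure IsCaratheodoryDecomposition {m : ℕ} (S : Finset (Finset (Fin m))) (x : Fin m → ℝ)
    (v : Fin (m + 1) → Finset (Fin m)) (w : Fin (m + 1) → ℝ) : Prop where
  mem : ∀ j, v j ∈ S
  nonneg : ∀ j, 0 ≤ w j
  sum_eq_one : ∑ j, w j = 1
  eq : x = ∑ j, w j • strategyVec (v j)

/-- `q` is the probability mass function of a possible output of the routine
`CaratheodoryDistribution` on the point `x`, with exploration parameter `μ` and spanner `b`: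
with probability `1 - μ` draw from a Caratheodory decomposition of
`(x - μ b̄) / (1 - μ)`, where `b̄` is the mean of the spanner, and with probability `μ` draw
uniformly from the spanner. -/
def IsCaratheodoryDistribution {m s : ℕ} (S : Finset (Finset (Fin m)))
    (b : Fin s → Finset (Fin m)) (μ : ℝ) (x : Fin m → ℝ) (q : Finset (Fin m) → ℝ) : Prop :=
  ∃ (v : Fin (m + 1) → Finset (Fin m)) (w : Fin (m + 1) → ℝ),
    IsCaratheodoryDecomposition S
      ((1 - μ)⁻¹ • (x - (μ / (s : ℝ)) • ∑ k, strategyVec (b k))) v w ∧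
    ∀ u, q u = (1 - μ) * (∑ j, if v j = u then w j else 0)
      + μ / (s : ℝ) * (∑ k, if b k = u then 1 else 0)

/-- The second moment matrix `𝔼[u uᵀ]` of a strategy `u` with probability mass function `q`. -/
def secondMoment {m : ℕ} (q : Finset (Fin m) → ℝ) : Matrix (Fin m) (Fin m) ℝ :=
  ∑ u, q u • Matrix.vecMulVec (strategyVec u) (strategyVec u)

/-- `P` is the pseudoinverse of the square matrix `A`: in a singular value decomposition
`A = U Σ Vᵀ` the nonzero singular values are inverted, `P = V Σ⁺ Uᵀ`
(in Lean, `0⁻¹ = 0`, so that `σ⁻¹` is `Σ⁺`). -/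
def IsPseudoinverse {m : ℕ} (A P : Matrix (Fin m) (Fin m) ℝ) : Prop :=
  ∃ (U V : Matrix (Fin m) (Fin m) ℝ) (σ : Fin m → ℝ),
    U.transpose * U = 1 ∧ V.transpose * V = 1 ∧ (∀ j, 0 ≤ σ j) ∧
    A = U * Matrix.diagonal σ * V.transpose ∧
    P = V * Matrix.diagonal (fun j => (σ j)⁻¹) * U.transpose

/-- The bias (exploration parameter) `μ_t` for `n` agents, `m` resources, costs up to `cmax`. -/
noncomputable def bias (n m : ℕ) (cmax : ℝ) (t : ℕ) : ℝ :=
  min ((n : ℝ) ^ (1 / 5 : ℝ) /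
    ((m : ℝ) ^ (7 / 5 : ℝ) * (t : ℝ) ^ (1 / 5 : ℝ) * cmax ^ (1 / 5 : ℝ))) (1 / 2)

/-- The step size `γ_t`. -/
noncomputable def stepSize (θ : ℝ) (n m : ℕ) (cmax : ℝ) (t : ℕ) : ℝ :=
  Real.sqrt (cmax * bias n m cmax t / (θ * (n : ℝ) ^ 3 * (m : ℝ) ^ 6 * (t : ℝ)))

/-- A run of `T` rounds of bandit gradient descent with Caratheodory exploration against an
adaptive adversary, on a probability space with filtration `ℱ`. Here `ℱ t` is the information
present in round `t` before the agent samples: it determines the cost vector `c t`, the point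
`α t` and the mixed strategy `q t` (as a probability mass function), and the pure strategies
sampled in earlier rounds. The pure strategy `p t` has the conditional law `q t` given `ℱ t`. -/
structure IsRun {Ω : Type*} {mΩ : MeasurableSpace Ω} (P : Measure Ω) (ℱ : Filtration ℕ mΩ)
    {m s : ℕ} (S : Finset (Finset (Fin m))) (θ : ℝ) (b : Fin s → Finset (Fin m))
    (n : ℕ) (cmax : ℝ) (T : ℕ)
    (c : ℕ → Ω → Fin m → ℝ) (α : ℕ → Ω → Fin s → ℝ)
    (q : ℕ → Ω → Finset (Fin m) → ℝ) (p : ℕ → Ω → Finset (Fin m)) : Prop where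
  /-- the adversary chooses `c t` from the information `ℱ t` -/
  cost_adapted : ∀ t ∈ Finset.Icc 1 T, ∀ e, Measurable[ℱ t] (fun ω => c t ω e)
  /-- the costs are bounded by `cmax` -/
  cost_bounded : ∀ t ∈ Finset.Icc 1 T, ∀ ω e, |c t ω e| ≤ cmax
  /-- the agent's point and mixed strategy are chosen from the information `ℱ t` -/
  point_adapted : ∀ t ∈ Finset.Icc 1 T, ∀ k, Measurable[ℱ t] (fun ω => α t ω k)
  law_adapted : ∀ t ∈ Finset.Icc 1 T, ∀ u, Measurable[ℱ t] (fun ω => q t ω u)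
  /-- the sampled strategy is known from the next round on -/
  play_adapted : ∀ t ∈ Finset.Icc 1 T, ∀ u, MeasurableSet[ℱ (t + 1)] {ω | p t ω = u}
  /-- the initial point is an arbitrary point of the bounded-away polytope -/
  init : ∀ ω, α 1 ω ∈ boundedAwayPolytope S θ b (bias n m cmax 1)
  /-- the mixed strategy is a Caratheodory distribution of `x t = B α t` -/
  law : ∀ t ∈ Finset.Icc 1 T, ∀ ω,
    IsCaratheodoryDistribution S b (bias n m cmax t) ((spannerMatrix b).mulVec (α t ω)) (q t ω)
  /-- given `ℱ t`, the pure strategy is sampled from the mixed strategy -/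
  sample : ∀ t ∈ Finset.Icc 1 T, ∀ u,
    P[Set.indicator {ω | p t ω = u} (fun _ => (1 : ℝ)) | ℱ t] =ᵐ[P] fun ω => q t ω u
  /-- projected gradient step with the estimator `⟨c t, p t⟩ M⁺ p t`, where `M = 𝔼[u uᵀ]` -/
  update : ∀ t ∈ Finset.Icc 1 T, ∀ ω, ∃ Mp : Matrix (Fin m) (Fin m) ℝ,
    IsPseudoinverse (secondMoment (q t ω)) Mp ∧
    IsProjection (boundedAwayPolytope S θ b (bias n m cmax (t + 1)))
      (α t ω - stepSize θ n m cmax t •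
        (spannerMatrix b).transpose.mulVec
          ((c t ω ⬝ᵥ strategyVec (p t ω)) • Mp.mulVec (strategyVec (p t ω))))
      (α (t + 1) ω)

/-- The regret of the plays `p 1, …, p T` for the costs `c 1, …, c T` with respect to the best
fixed pure strategy in hindsight. -/
noncomputable def regret {m : ℕ} (S : Finset (Finset (Fin m))) (hS : S.Nonempty) (T : ℕ)
    (c : ℕ → Fin m → ℝ) (p : ℕ → Finset (Fin m)) : ℝ :=
  (∑ t ∈ Finset.Icc 1 T, c t ⬝ᵥ strategyVec (p t)) -
    S.inf' hS (fun u => ∑ t ∈ Finset.Icc 1 T, c t ⬝ᵥ strategyVec u)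

end BGDCE

/-! In spanner coordinates the problem is Euclidean and well conditioned. A strategy v has a
coordinate vector a_v with entries in [-θ, θ], the spanner strategies are the unit vectors, and
playing the spanner with mass μ makes the second moment W = 𝔼[a aᵀ] at least (μ/s)·1. There Bᵀ M⁺ B
= W⁻¹ (`IsSpanner.transpose_mulVec_pseudoinverse`), so the algorithm is projected gradient descent
with gradient g = (h·a_v) W⁻¹ a_v for h = Bᵀc. This g is unbiased (`IsExploring.mean_gradEstimate`);
with costs at most G its mean square is at most G²s²/μ, because tr(W⁻¹W) = s, and its worst-case
square at most G²s³θ²/μ².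

Pathwise, descent on the growing polytopes bounds Σ (g·(x - u_t) - γ/2 |g|²) by 4θ²s/γ_T, where u_t
is the comparator u shrunk into the t-th polytope (`IsSpanner.sum_gradient_le`). The rest of the
regret is one random variable per round, `excess`: its conditional mean is at most the cost of u_t
plus γG²s²/(2μ), and its centered version is a bounded martingale difference. Azuma for each fixed u
and a union bound over at most 2^m strategies give `IsRun.regret_high_probability`; the union is
needed because the best u is known only in hindsight.

The exploration cost is of order T^{4/5}. Some other terms have too large a power of n or cmax, or a
negative power of cmax. Each of these is capped by the trivial bound W = 2·m·cmax·T and estimated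
through min(A, W) ≤ √(AW) (`le_min_add`, `min_le_of_mul_le`). No logarithm of T arises. -/

namespace BGDCE

/-! ### Sampling from conditional laws and the Azuma-Hoeffding inequality. -/

/-- Hoeffding's lemma for a finitely supported centered distribution. -/
theorem sum_mul_exp_le {V : Type*} [Fintype V] (q d : V → ℝ) (hq : ∀ v, 0 ≤ q v)
    (hq1 : ∑ v, q v = 1) {R : ℝ} (hR : 0 < R) (hd : ∀ v, q v ≠ 0 → |d v| ≤ R)
    (hmean : ∑ v, q v * d v = 0) (l : ℝ) :
    ∑ v, q v * Real.exp (l * d v) ≤ Real.exp (l ^ 2 * R ^ 2 / 2) := by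
  have key : ∀ v, q v * Real.exp (l * d v) ≤
      q v * (Real.cosh (l * R) + d v / R * Real.sinh (l * R)) := by
    intro v
    rcases eq_or_ne (q v) 0 with h0 | h0
    · simp [h0]
    refine mul_le_mul_of_nonneg_left ?_ (hq v)
    have h := abs_le.1 (hd v h0)
    have ha : 0 ≤ (1 + d v / R) / 2 := by
      have : -1 ≤ d v / R := by rw [le_div_iff₀ hR]; linarith
      linarith
    have hb : 0 ≤ (1 - d v / R) / 2 := by
      have : d v / R ≤ 1 := by rw [div_le_iff₀ hR]; linarith
      linarith
    -- The chord of exp over [-lR, lR] is affine in `d v`, so after averaging the mean-zero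
    -- condition removes the sinh part.
    have hc := convexOn_exp.2 (Set.mem_univ (l * R)) (Set.mem_univ (-(l * R))) ha hb (by ring)
    simp only [smul_eq_mul] at hc
    have e1 : (1 + d v / R) / 2 * (l * R) + (1 - d v / R) / 2 * -(l * R) = l * d v := by
      field_simp; ring
    rw [e1] at hc
    rw [Real.cosh_eq, Real.sinh_eq]
    linarith
  calc ∑ v, q v * Real.exp (l * d v)
      ≤ ∑ v, q v * (Real.cosh (l * R) + d v / R * Real.sinh (l * R)) :=
        Finset.sum_le_sum fun v _ => key v
    _ = (∑ v, q v) * Real.cosh (l * R) + (∑ v, q v * d v) * (Real.sinh (l * R) / R) := by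
        rw [Finset.sum_mul, Finset.sum_mul, ← Finset.sum_add_distrib]
        refine Finset.sum_congr rfl fun v _ => ?_
        ring
    _ = Real.cosh (l * R) := by rw [hq1, hmean]; ring
    _ ≤ Real.exp ((l * R) ^ 2 / 2) := Real.cosh_le_exp_half_sq _
    _ = _ := by rw [mul_pow]

/-- Integrating a function of a sampled value against its conditional law. -/
theorem integral_comp_sample {Ω V : Type*} {𝓖 mΩ : MeasurableSpace Ω} [Fintype V] {P : Measure Ω}
    [IsProbabilityMeasure P] (h𝓖 : 𝓖 ≤ mΩ) {p : Ω → V} {q f : Ω → V → ℝ}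
    (hp : ∀ v, MeasurableSet {ω | p ω = v})
    (hf : ∀ v, Measurable[𝓖] fun ω => f ω v) {C : ℝ} (hC : ∀ ω v, |f ω v| ≤ C)
    (hs : ∀ v, P[Set.indicator {ω | p ω = v} (fun _ => (1 : ℝ)) | 𝓖] =ᵐ[P] fun ω => q ω v) :
    ∫ ω, f ω (p ω) ∂P = ∫ ω, ∑ v, q ω v * f ω v ∂P ∧
      Integrable (fun ω => ∑ v, q ω v * f ω v) P := by
  classical
  have hind : ∀ v, Integrable (Set.indicator {ω | p ω = v} (fun _ => (1 : ℝ))) P := fun v =>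
    (integrable_const (1 : ℝ)).indicator (hp v)
  have hfi : ∀ v, AEStronglyMeasurable (fun ω => f ω v) P := fun v =>
    ((hf v).mono h𝓖 le_rfl).aestronglyMeasurable
  have hfind : ∀ v, Integrable
      ((fun ω => f ω v) * Set.indicator {ω | p ω = v} (fun _ => (1 : ℝ))) P := fun v =>
    (hind v).bdd_mul (hfi v) (Filter.Eventually.of_forall fun ω => hC ω v)
  have hce : ∀ v, P[(fun ω => f ω v) * Set.indicator {ω | p ω = v} (fun _ => (1 : ℝ)) | 𝓖]
      =ᵐ[P] fun ω => q ω v * f ω v := by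
    intro v
    refine (condExp_mul_of_stronglyMeasurable_left (hf v).stronglyMeasurable
      (hfind v) (hind v)).trans ?_
    filter_upwards [hs v] with ω hω
    simp [hω, mul_comm]
  have hqi : ∀ v, Integrable (fun ω => q ω v * f ω v) P := fun v =>
    integrable_condExp.congr (hce v)
  refine ⟨?_, integrable_finsetSum _ fun v _ => hqi v⟩
  have e : ∀ ω, f ω (p ω) =
      ∑ v, ((fun ω => f ω v) * Set.indicator {ω | p ω = v} (fun _ => (1 : ℝ))) ω := by
    intro ω
    rw [Finset.sum_eq_single (p ω)]
    · simp
    · intro v _ hv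
      have : p ω ≠ v := fun h => hv h.symm
      simp [Set.indicator, this]
    · simp
  simp_rw [e]
  rw [integral_finsetSum _ fun v _ => hfind v, integral_finsetSum _ fun v _ => hqi v]
  refine Finset.sum_congr rfl fun v _ => ?_
  rw [← integral_condExp h𝓖, integral_congr_ae (hce v)]

theorem measurable_comp_sample {Ω V : Type*} {𝓖 : MeasurableSpace Ω} [Fintype V] {p : Ω → V}
    {f : Ω → V → ℝ} (hp : ∀ v, MeasurableSet {ω | p ω = v})
    (hf : ∀ v, Measurable fun ω => f ω v) : Measurable fun ω => f ω (p ω) := by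
  classical
  have e : (fun ω => f ω (p ω)) = fun ω => ∑ v, if p ω = v then f ω v else 0 := by
    ext ω; simp
  rw [e]
  exact Finset.measurable_sum _ fun v _ => Measurable.ite (hp v) (hf v) measurable_const

section Azuma

variable {Ω V : Type*} {mΩ : MeasurableSpace Ω} [Fintype V] {P : Measure Ω}
  [IsProbabilityMeasure P] {ℱ : Filtration ℕ mΩ} {p : ℕ → Ω → V} {q d : ℕ → Ω → V → ℝ} {T : ℕ}
  {R : ℕ → ℝ}

theorem measurable_sum_sample
    (hp : ∀ t ∈ Finset.Icc 1 T, ∀ v, MeasurableSet[ℱ (t + 1)] {ω | p t ω = v})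
    (hd : ∀ t ∈ Finset.Icc 1 T, ∀ v, Measurable[ℱ t] fun ω => d t ω v) {k : ℕ} (hk : k ≤ T) :
    Measurable[ℱ (k + 1)] fun ω => ∑ t ∈ Finset.Icc 1 k, d t ω (p t ω) := by
  refine Finset.measurable_sum _ fun t ht => ?_
  have ht' := Finset.mem_Icc.1 ht
  have htT : t ∈ Finset.Icc 1 T := Finset.mem_Icc.2 ⟨ht'.1, ht'.2.trans hk⟩
  exact measurable_comp_sample
    (fun v => ℱ.mono (by omega : t + 1 ≤ k + 1) _ (hp t htT v))
    (fun v => (hd t htT v).mono (ℱ.mono (by omega)) le_rfl)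

/-- Peel off the last round. `ℱ (k + 1)` already knows the plays of rounds 1 to k but not that of
round k + 1, so the earlier exponential factors out and Hoeffding's lemma applies conditionally. -/
theorem integral_exp_sum_le
    (hp : ∀ t ∈ Finset.Icc 1 T, ∀ v, MeasurableSet[ℱ (t + 1)] {ω | p t ω = v})
    (hd : ∀ t ∈ Finset.Icc 1 T, ∀ v, Measurable[ℱ t] fun ω => d t ω v)
    (hs : ∀ t ∈ Finset.Icc 1 T, ∀ v,
      P[Set.indicator {ω | p t ω = v} (fun _ => (1 : ℝ)) | ℱ t] =ᵐ[P] fun ω => q t ω v)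
    (hq : ∀ t ∈ Finset.Icc 1 T, ∀ ω v, 0 ≤ q t ω v)
    (hq1 : ∀ t ∈ Finset.Icc 1 T, ∀ ω, ∑ v, q t ω v = 1)
    (hmean : ∀ t ∈ Finset.Icc 1 T, ∀ ω, ∑ v, q t ω v * d t ω v = 0)
    (hR : ∀ t ∈ Finset.Icc 1 T, 0 < R t)
    (hdR : ∀ t ∈ Finset.Icc 1 T, ∀ ω v, |d t ω v| ≤ R t) (l : ℝ) {k : ℕ} (hk : k ≤ T) :
    ∫ ω, Real.exp (l * ∑ t ∈ Finset.Icc 1 k, d t ω (p t ω)) ∂P ≤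
      Real.exp (l ^ 2 * (∑ t ∈ Finset.Icc 1 k, R t ^ 2) / 2) := by
  induction k with
  | zero => simp
  | succ k ih =>
    have hkT : k + 1 ∈ Finset.Icc 1 T := Finset.mem_Icc.2 ⟨by omega, hk⟩
    have hbd : ∀ ω, |∑ t ∈ Finset.Icc 1 k, d t ω (p t ω)| ≤ ∑ t ∈ Finset.Icc 1 k, R t := by
      intro ω
      refine (Finset.abs_sum_le_sum_abs _ _).trans (Finset.sum_le_sum fun t ht => ?_)
      have ht' := Finset.mem_Icc.1 ht
      exact hdR t (Finset.mem_Icc.2 ⟨ht'.1, by omega⟩) ω _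
    have hm := measurable_sum_sample hp hd (k := k) (by omega)
    have hmexp : Measurable[ℱ (k + 1)]
        fun ω => Real.exp (l * ∑ t ∈ Finset.Icc 1 k, d t ω (p t ω)) :=
      Real.measurable_exp.comp (hm.const_mul l)
    have hexpbd : ∀ ω, Real.exp (l * ∑ t ∈ Finset.Icc 1 k, d t ω (p t ω)) ≤
        Real.exp (|l| * ∑ t ∈ Finset.Icc 1 k, R t) := by
      intro ω
      refine Real.exp_le_exp.2 ((le_abs_self _).trans ?_)
      rw [abs_mul]
      exact mul_le_mul_of_nonneg_left (hbd ω) (abs_nonneg _)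
    have hint : Integrable
        (fun ω => Real.exp (l * ∑ t ∈ Finset.Icc 1 k, d t ω (p t ω))) P := by
      refine Integrable.of_bound (hmexp.mono (ℱ.le _) le_rfl).aestronglyMeasurable
        (Real.exp (|l| * ∑ t ∈ Finset.Icc 1 k, R t)) (Filter.Eventually.of_forall fun ω => ?_)
      rw [Real.norm_eq_abs, Real.abs_exp]
      exact hexpbd ω
    obtain ⟨e, hi⟩ := integral_comp_sample (P := P) (ℱ.le (k + 1)) (p := p (k + 1))
      (q := q (k + 1))
      (f := fun ω v => Real.exp (l * ∑ t ∈ Finset.Icc 1 k, d t ω (p t ω)) *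
        Real.exp (l * d (k + 1) ω v))
      (C := Real.exp (|l| * ∑ t ∈ Finset.Icc 1 k, R t) * Real.exp (|l| * R (k + 1)))
      (fun v => ℱ.le _ _ (hp _ hkT v))
      (fun v => hmexp.mul (Real.measurable_exp.comp ((hd _ hkT v).const_mul l)))
      (fun ω v => by
        rw [abs_mul, Real.abs_exp, Real.abs_exp]
        refine mul_le_mul (hexpbd ω) ?_ (Real.exp_pos _).le (Real.exp_pos _).le
        refine Real.exp_le_exp.2 ((le_abs_self _).trans ?_)
        rw [abs_mul]
        exact mul_le_mul_of_nonneg_left (hdR _ hkT ω v) (abs_nonneg _))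
      (hs _ hkT)
    have e2 : ∀ ω, Real.exp (l * ∑ t ∈ Finset.Icc 1 (k + 1), d t ω (p t ω)) =
        Real.exp (l * ∑ t ∈ Finset.Icc 1 k, d t ω (p t ω)) *
          Real.exp (l * d (k + 1) ω (p (k + 1) ω)) := by
      intro ω
      rw [Finset.sum_Icc_succ_top (by omega), mul_add, Real.exp_add]
    simp_rw [e2]
    rw [e]
    calc _ ≤ ∫ ω, Real.exp (l * ∑ t ∈ Finset.Icc 1 k, d t ω (p t ω)) *
            Real.exp (l ^ 2 * R (k + 1) ^ 2 / 2) ∂P := by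
          refine integral_mono hi (hint.mul_const _) fun ω => ?_
          have h := sum_mul_exp_le (q (k + 1) ω) (d (k + 1) ω) (hq _ hkT ω) (hq1 _ hkT ω)
            (hR _ hkT) (fun v _ => hdR _ hkT ω v) (hmean _ hkT ω) l
          have h2 := mul_le_mul_of_nonneg_left h
            (Real.exp_pos (l * ∑ t ∈ Finset.Icc 1 k, d t ω (p t ω))).le
          rw [Finset.mul_sum] at h2
          refine le_trans (le_of_eq (Finset.sum_congr rfl fun v _ => ?_)) h2
          ring
      _ ≤ _ := by
          rw [integral_mul_const, Finset.sum_Icc_succ_top (by omega), mul_add, add_div,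
            Real.exp_add]
          exact mul_le_mul_of_nonneg_right (ih (by omega)) (Real.exp_pos _).le

/-- The Azuma-Hoeffding inequality for sums of functions of values sampled from conditional
laws. -/
theorem measureReal_sum_ge_le
    (hp : ∀ t ∈ Finset.Icc 1 T, ∀ v, MeasurableSet[ℱ (t + 1)] {ω | p t ω = v})
    (hd : ∀ t ∈ Finset.Icc 1 T, ∀ v, Measurable[ℱ t] fun ω => d t ω v)
    (hs : ∀ t ∈ Finset.Icc 1 T, ∀ v,
      P[Set.indicator {ω | p t ω = v} (fun _ => (1 : ℝ)) | ℱ t] =ᵐ[P] fun ω => q t ω v)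
    (hq : ∀ t ∈ Finset.Icc 1 T, ∀ ω v, 0 ≤ q t ω v)
    (hq1 : ∀ t ∈ Finset.Icc 1 T, ∀ ω, ∑ v, q t ω v = 1)
    (hmean : ∀ t ∈ Finset.Icc 1 T, ∀ ω, ∑ v, q t ω v * d t ω v = 0)
    (hR : ∀ t ∈ Finset.Icc 1 T, 0 < R t)
    (hdR : ∀ t ∈ Finset.Icc 1 T, ∀ ω v, |d t ω v| ≤ R t)
    (hV : 0 < ∑ t ∈ Finset.Icc 1 T, R t ^ 2) {x : ℝ} (hx : 0 ≤ x) :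
    P.real {ω | Real.sqrt (2 * (∑ t ∈ Finset.Icc 1 T, R t ^ 2) * x) ≤
      ∑ t ∈ Finset.Icc 1 T, d t ω (p t ω)} ≤ Real.exp (-x) := by
  set U := ∑ t ∈ Finset.Icc 1 T, R t ^ 2 with hU
  set ε := Real.sqrt (2 * U * x) with hε
  have hε0 : 0 ≤ ε := Real.sqrt_nonneg _
  have hε2 : ε ^ 2 = 2 * U * x := Real.sq_sqrt (by positivity)
  have hm := (measurable_sum_sample hp hd (k := T) le_rfl).mono (ℱ.le _) le_rfl
  have hint : Integrable
      (fun ω => Real.exp (ε / U * ∑ t ∈ Finset.Icc 1 T, d t ω (p t ω))) P := by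
    refine Integrable.of_bound
      (Real.measurable_exp.comp (hm.const_mul _)).aestronglyMeasurable
      (Real.exp (ε / U * ∑ t ∈ Finset.Icc 1 T, R t)) (Filter.Eventually.of_forall fun ω => ?_)
    rw [Real.norm_eq_abs, Real.abs_exp]
    refine Real.exp_le_exp.2 (mul_le_mul_of_nonneg_left ?_ (by positivity))
    exact Finset.sum_le_sum fun t ht => (le_abs_self _).trans (hdR t ht ω _)
  -- Chernoff at the slope ε / U, which minimizes -lε + l²U/2.
  have h := measure_ge_le_exp_mul_mgf (μ := P) ε (t := ε / U) (by positivity) hint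
  refine h.trans ?_
  have h2 := integral_exp_sum_le hp hd hs hq hq1 hmean hR hdR (ε / U) le_rfl
  calc _ ≤ Real.exp (-(ε / U) * ε) * Real.exp ((ε / U) ^ 2 * U / 2) :=
        mul_le_mul_of_nonneg_left h2 (Real.exp_pos _).le
    _ = Real.exp (-x) := by
        rw [← Real.exp_add]
        congr 1
        field_simp
        rw [hε2]; ring

end Azuma

/-! ### Spanner coordinates of strategies. -/

section Coordinates

open Matrix

variable {m s : ℕ} {S : Finset (Finset (Fin m))} {θ : ℝ} {b : Fin s → Finset (Fin m)}

theorem spannerMatrix_mulVec (b : Fin s → Finset (Fin m)) (a : Fin s → ℝ) :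
    (spannerMatrix b).mulVec a = ∑ k, a k • strategyVec (b k) := by
  ext e
  simp [spannerMatrix, Matrix.mulVec, dotProduct, mul_comm]

theorem IsSpanner.mulVec_injective (h : IsSpanner S θ b) :
    Function.Injective (spannerMatrix b).mulVec := by
  rw [Matrix.mulVec_injective_iff]
  exact h.linearIndependent

theorem strategyVec_mem {v : Finset (Fin m)} (hv : v ∈ S) :
    strategyVec v ∈ descriptionPolytope S :=
  subset_convexHull ℝ _ ⟨v, hv, rfl⟩

/-- Coordinates of the strategies with respect to a spanner. -/
theorem IsSpanner.exists_coords (hθ : 1 ≤ θ) (h : IsSpanner S θ b) :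
    ∃ a : Finset (Fin m) → Fin s → ℝ,
      (∀ v ∈ S, (spannerMatrix b).mulVec (a v) = strategyVec v) ∧
      (∀ v ∉ S, a v = 0) ∧ (∀ v k, |a v k| ≤ θ) ∧ ∀ k, a (b k) = Pi.single k 1 := by
  classical
  have h1 : ∀ v, ∃ x : Fin s → ℝ, (v ∈ S → (spannerMatrix b).mulVec x = strategyVec v) ∧
      (v ∉ S → x = 0) ∧ ∀ k, |x k| ≤ θ := by
    intro v
    by_cases hv : v ∈ S
    · obtain ⟨x, hx, hb⟩ := h.span _ (strategyVec_mem hv)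
      refine ⟨x, fun _ => by rw [spannerMatrix_mulVec, hx], fun h => absurd hv h, fun k => ?_⟩
      exact abs_le_of_sq_le_sq (hb k) (by linarith)
    -- The default 0 outside `S` makes the bounds on coordinates and costs hold for every subset, so
    -- later sums can run over the whole type.
    · exact ⟨0, fun h => absurd h hv, fun _ => rfl, fun k => by simp; linarith⟩
  choose a ha h0 hb using h1
  refine ⟨a, ha, h0, hb, fun k => h.mulVec_injective ?_⟩
  rw [ha _ (h.mem k)]
  ext e
  simp [spannerMatrix]

theorem IsSpanner.card_le (h : IsSpanner S θ b) : s ≤ m := by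
  simpa using h.linearIndependent.fintype_card_le_finrank

theorem IsSpanner.card_pos (h : IsSpanner S θ b) (hne : ∃ u ∈ S, u.Nonempty) : 0 < s := by
  rcases Nat.eq_zero_or_pos s with rfl | h0
  · obtain ⟨u, hu, e, he⟩ := hne
    obtain ⟨x, hx, -⟩ := h.span _ (strategyVec_mem hu)
    have := congrFun hx e
    simp [strategyVec, he] at this
  · exact h0

end Coordinates

/-! ### The importance weighted estimator and its moments. -/

section Moment

open Matrix

/-- The second moment matrix of the vectors `a v` under the weights `q v`. -/
noncomputable def momentMatrix {V : Type*} [Fintype V] {s : ℕ} (a : V → Fin s → ℝ) (q : V → ℝ) :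
    Matrix (Fin s) (Fin s) ℝ :=
  ∑ v, q v • Matrix.vecMulVec (a v) (a v)

/-- A distribution with mean `x` on the vectors `a v` whose second moment is at least
`(μ / s) 1`. -/
structure IsExploring {V : Type*} [Fintype V] {s : ℕ} (a : V → Fin s → ℝ) (q : V → ℝ) (μ : ℝ)
    (x : Fin s → ℝ) : Prop where
  nonneg : ∀ v, 0 ≤ q v
  sum_eq_one : ∑ v, q v = 1
  mean : ∀ z, ∑ v, q v * (a v ⬝ᵥ z) = x ⬝ᵥ z
  explore : ∀ y : Fin s → ℝ, μ / s * (y ⬝ᵥ y) ≤ ∑ v, q v * (a v ⬝ᵥ y) ^ 2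

/-- The importance weighted estimate of the linear cost `h` after seeing its value at `a v`. -/
noncomputable def gradEstimate {V : Type*} [Fintype V] {s : ℕ} (a : V → Fin s → ℝ) (q : V → ℝ)
    (h : Fin s → ℝ) (v : V) : Fin s → ℝ :=
  (h ⬝ᵥ a v) • ((momentMatrix a q)⁻¹ *ᵥ a v)

variable {V : Type*} [Fintype V] {s : ℕ} {a : V → Fin s → ℝ} {q : V → ℝ} {μ : ℝ}
  {x : Fin s → ℝ}

theorem momentMatrix_apply (a : V → Fin s → ℝ) (q : V → ℝ) (i j : Fin s) :
    momentMatrix a q i j = ∑ v, q v * (a v i * a v j) := by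
  simp [momentMatrix, Matrix.sum_apply, Matrix.vecMulVec_apply]

theorem dotProduct_momentMatrix_mulVec (a : V → Fin s → ℝ) (q : V → ℝ) (y z : Fin s → ℝ) :
    y ⬝ᵥ (momentMatrix a q *ᵥ z) = ∑ v, q v * ((y ⬝ᵥ a v) * (a v ⬝ᵥ z)) := by
  rw [momentMatrix, Matrix.sum_mulVec, dotProduct_sum]
  refine Finset.sum_congr rfl fun v _ => ?_
  rw [Matrix.smul_mulVec, dotProduct_smul, Matrix.vecMulVec_mulVec]
  simp [mul_comm]

theorem momentMatrix_transpose (a : V → Fin s → ℝ) (q : V → ℝ) :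
    (momentMatrix a q)ᵀ = momentMatrix a q := by
  ext i j
  rw [Matrix.transpose_apply, momentMatrix_apply, momentMatrix_apply]
  exact Finset.sum_congr rfl fun v _ => by ring

theorem IsExploring.le_quadratic (h : IsExploring a q μ x) (y : Fin s → ℝ) :
    μ / s * (y ⬝ᵥ y) ≤ y ⬝ᵥ (momentMatrix a q *ᵥ y) := by
  rw [dotProduct_momentMatrix_mulVec]
  refine (h.explore y).trans (le_of_eq (Finset.sum_congr rfl fun v _ => ?_))
  rw [dotProduct_comm y, sq]

theorem IsExploring.isUnit (h : IsExploring a q μ x) (hμ : 0 < μ) (hs : 0 < s) :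
    IsUnit (momentMatrix a q) := by
  rw [← Matrix.mulVec_injective_iff_isUnit]
  refine (injective_iff_map_eq_zero (momentMatrix a q).mulVecLin).2 fun y hy => ?_
  have h1 := h.le_quadratic y
  rw [Matrix.mulVecLin_apply] at hy
  rw [hy, dotProduct_zero] at h1
  have hc : 0 < μ / s := div_pos hμ (by exact_mod_cast hs)
  have h2 : y ⬝ᵥ y ≤ 0 := by
    by_contra hcon
    push Not at hcon
    nlinarith [mul_pos hc hcon]
  exact dotProduct_self_eq_zero.1 (le_antisymm h2 (by
    simpa [dotProduct] using Finset.sum_nonneg fun i _ => mul_self_nonneg (y i)))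

theorem IsExploring.mulVec_inv (h : IsExploring a q μ x) (hμ : 0 < μ) (hs : 0 < s)
    (z : Fin s → ℝ) : momentMatrix a q *ᵥ ((momentMatrix a q)⁻¹ *ᵥ z) = z := by
  rw [Matrix.mulVec_mulVec, Matrix.mul_nonsing_inv _ ((Matrix.isUnit_iff_isUnit_det _).1
    (h.isUnit hμ hs)), Matrix.one_mulVec]

theorem inv_momentMatrix_symm (a : V → Fin s → ℝ) (q : V → ℝ) (y z : Fin s → ℝ) :
    ((momentMatrix a q)⁻¹ *ᵥ y) ⬝ᵥ z = y ⬝ᵥ ((momentMatrix a q)⁻¹ *ᵥ z) := by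
  rw [Matrix.dotProduct_mulVec, ← Matrix.mulVec_transpose, Matrix.transpose_nonsing_inv,
    momentMatrix_transpose]

/-- With W the moment matrix, 𝔼[(c·a)(a·W⁻¹z)] = c·W W⁻¹ z. -/
theorem IsExploring.mean_gradEstimate (h : IsExploring a q μ x) (hμ : 0 < μ) (hs : 0 < s)
    (c z : Fin s → ℝ) : ∑ v, q v * (gradEstimate a q c v ⬝ᵥ z) = c ⬝ᵥ z := by
  conv_rhs => rw [← h.mulVec_inv hμ hs z, dotProduct_momentMatrix_mulVec]
  refine Finset.sum_congr rfl fun v _ => ?_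
  rw [gradEstimate, smul_dotProduct, inv_momentMatrix_symm, smul_eq_mul]

/-- The sum is the trace of W⁻¹W. This identity saves a factor of order 1/μ in the mean square
compared with the worst case. -/
theorem IsExploring.sum_leverage (h : IsExploring a q μ x) (hμ : 0 < μ) (hs : 0 < s) :
    ∑ v, q v * (a v ⬝ᵥ ((momentMatrix a q)⁻¹ *ᵥ a v)) = s := by
  have e : ((momentMatrix a q)⁻¹ * momentMatrix a q).trace = s := by
    rw [Matrix.nonsing_inv_mul _ ((Matrix.isUnit_iff_isUnit_det _).1 (h.isUnit hμ hs))]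
    simp
  rw [← e]
  simp only [Matrix.trace, Matrix.diag_apply, Matrix.mul_apply, momentMatrix_apply a q,
    dotProduct, Matrix.mulVec, Finset.mul_sum]
  rw [Finset.sum_comm]
  refine Finset.sum_congr rfl fun i _ => ?_
  rw [Finset.sum_comm]
  exact Finset.sum_congr rfl fun j _ => Finset.sum_congr rfl fun v _ => by ring

/-- The lower bound on the quadratic form, tested on y = W⁻¹ a_v, where y·Wy = a_v·W⁻¹a_v. -/
theorem IsExploring.sq_inv_le (h : IsExploring a q μ x) (hμ : 0 < μ) (hs : 0 < s) (v : V) :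
    ((momentMatrix a q)⁻¹ *ᵥ a v) ⬝ᵥ ((momentMatrix a q)⁻¹ *ᵥ a v) ≤
      s / μ * (a v ⬝ᵥ ((momentMatrix a q)⁻¹ *ᵥ a v)) := by
  have h1 := h.le_quadratic ((momentMatrix a q)⁻¹ *ᵥ a v)
  rw [h.mulVec_inv hμ hs, dotProduct_comm _ (a v)] at h1
  have hs' : (0 : ℝ) < s := by exact_mod_cast hs
  have h2 := mul_le_mul_of_nonneg_left h1 (div_pos hs' hμ).le
  refine le_trans (le_of_eq ?_) h2
  field_simp

theorem sq_dotProduct_le (y z : Fin s → ℝ) : (y ⬝ᵥ z) ^ 2 ≤ (y ⬝ᵥ y) * (z ⬝ᵥ z) := by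
  have := Finset.sum_mul_sq_le_sq_mul_sq Finset.univ y z
  simpa [dotProduct, sq] using this

theorem dotProduct_self_nonneg_real (y : Fin s → ℝ) : 0 ≤ y ⬝ᵥ y :=
  Finset.sum_nonneg fun i _ => mul_self_nonneg (y i)

theorem dotProduct_self_le_of_abs_le {y : Fin s → ℝ} {r : ℝ} (hy : ∀ k, |y k| ≤ r) :
    y ⬝ᵥ y ≤ s * r ^ 2 := by
  refine (Finset.sum_le_card_nsmul _ _ (r ^ 2) fun k _ => ?_).trans (by simp)
  rw [← sq]
  exact sq_le_sq' (by linarith [(abs_le.1 (hy k)).1]) (abs_le.1 (hy k)).2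

/-- With Y = |W⁻¹a_v|² and κ = a_v·W⁻¹a_v, one has Y ≤ (s/μ)κ, and κ² ≤ |a_v|² Y by Cauchy-Schwarz.
Eliminate κ and divide by Y. -/
theorem IsExploring.sq_inv_le_const (h : IsExploring a q μ x) (hμ : 0 < μ) (hs : 0 < s) {θ : ℝ}
    (ha : ∀ v k, |a v k| ≤ θ) (v : V) :
    ((momentMatrix a q)⁻¹ *ᵥ a v) ⬝ᵥ ((momentMatrix a q)⁻¹ *ᵥ a v) ≤
      s ^ 3 * θ ^ 2 / μ ^ 2 := by
  have h1 := h.sq_inv_le hμ hs v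
  have h2 := sq_dotProduct_le (a v) ((momentMatrix a q)⁻¹ *ᵥ a v)
  have h3 := dotProduct_self_le_of_abs_le (ha v)
  have h0 := dotProduct_self_nonneg_real ((momentMatrix a q)⁻¹ *ᵥ a v)
  set Y := ((momentMatrix a q)⁻¹ *ᵥ a v) ⬝ᵥ ((momentMatrix a q)⁻¹ *ᵥ a v)
  set κ := a v ⬝ᵥ ((momentMatrix a q)⁻¹ *ᵥ a v)
  have hs' : (0 : ℝ) < s := by exact_mod_cast hs
  rcases h0.eq_or_lt with h00 | h00
  · rw [← h00]; positivity
  have h4 : Y ^ 2 ≤ (s / μ) ^ 2 * (s * θ ^ 2) * Y := by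
    calc Y ^ 2 ≤ (s / μ * κ) ^ 2 := pow_le_pow_left₀ h0 h1 2
      _ = (s / μ) ^ 2 * κ ^ 2 := by ring
      _ ≤ (s / μ) ^ 2 * (s * θ ^ 2 * Y) := by
          refine mul_le_mul_of_nonneg_left (h2.trans ?_) (by positivity)
          exact mul_le_mul_of_nonneg_right h3 h0
      _ = _ := by ring
  have h5 : Y ≤ (s / μ) ^ 2 * (s * θ ^ 2) := by
    by_contra hcon
    push Not at hcon
    nlinarith
  refine h5.trans (le_of_eq ?_)
  field_simp

theorem gradEstimate_dotProduct_self (a : V → Fin s → ℝ) (q : V → ℝ) (c : Fin s → ℝ) (v : V) :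
    gradEstimate a q c v ⬝ᵥ gradEstimate a q c v = (c ⬝ᵥ a v) ^ 2 *
      (((momentMatrix a q)⁻¹ *ᵥ a v) ⬝ᵥ ((momentMatrix a q)⁻¹ *ᵥ a v)) := by
  rw [gradEstimate, smul_dotProduct, dotProduct_smul, smul_eq_mul, smul_eq_mul]; ring

theorem IsExploring.sq_gradEstimate_le (h : IsExploring a q μ x) (hμ : 0 < μ) (hs : 0 < s)
    {θ G : ℝ} (ha : ∀ v k, |a v k| ≤ θ) {c : Fin s → ℝ} {v : V} (hc : |c ⬝ᵥ a v| ≤ G) :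
    gradEstimate a q c v ⬝ᵥ gradEstimate a q c v ≤ G ^ 2 * (s ^ 3 * θ ^ 2 / μ ^ 2) := by
  rw [gradEstimate_dotProduct_self]
  refine mul_le_mul ?_ (h.sq_inv_le_const hμ hs ha v) (dotProduct_self_nonneg_real _) (sq_nonneg _)
  exact sq_le_sq' (by linarith [(abs_le.1 hc).1]) (abs_le.1 hc).2

theorem IsExploring.mean_sq_gradEstimate_le (h : IsExploring a q μ x) (hμ : 0 < μ) (hs : 0 < s)
    {G : ℝ} {c : Fin s → ℝ} (hc : ∀ v, q v ≠ 0 → |c ⬝ᵥ a v| ≤ G) :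
    ∑ v, q v * (gradEstimate a q c v ⬝ᵥ gradEstimate a q c v) ≤ G ^ 2 * (s ^ 2 / μ) := by
  have hs' : (0 : ℝ) < s := by exact_mod_cast hs
  calc _ ≤ ∑ v, G ^ 2 * (s / μ) * (q v * (a v ⬝ᵥ ((momentMatrix a q)⁻¹ *ᵥ a v))) := by
        refine Finset.sum_le_sum fun v _ => ?_
        rcases eq_or_ne (q v) 0 with h0 | h0
        · simp [h0]
        rw [gradEstimate_dotProduct_self]
        have h1 := h.sq_inv_le hμ hs v
        have h2 : (c ⬝ᵥ a v) ^ 2 ≤ G ^ 2 :=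
          sq_le_sq' (by linarith [(abs_le.1 (hc v h0)).1]) (abs_le.1 (hc v h0)).2
        have h3 := mul_le_mul h2 h1 (dotProduct_self_nonneg_real _) (sq_nonneg _)
        refine (mul_le_mul_of_nonneg_left h3 (h.nonneg v)).trans (le_of_eq ?_)
        ring
    _ = _ := by
        rw [← Finset.mul_sum, h.sum_leverage hμ hs]
        field_simp

end Moment

/-! ### The pseudoinverse in spanner coordinates. -/

section Pseudoinverse

open Matrix

/-- The only property of the pseudoinverse that the proof uses; zero singular values are harmless
since σσ⁻¹σ = σ also at 0. -/
theorem IsPseudoinverse.mul_mul {m : ℕ} {A P : Matrix (Fin m) (Fin m) ℝ}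
    (h : IsPseudoinverse A P) : A * P * A = A := by
  obtain ⟨U, V, σ, hU, hV, -, rfl, rfl⟩ := h
  have e : Matrix.diagonal σ * Matrix.diagonal (fun j => (σ j)⁻¹) * Matrix.diagonal σ =
      Matrix.diagonal σ := by
    rw [Matrix.diagonal_mul_diagonal, Matrix.diagonal_mul_diagonal]
    congr 1
    ext j
    exact mul_inv_mul_cancel (σ j)
  calc _ = U * Matrix.diagonal σ * (V.transpose * V) * Matrix.diagonal (fun j => (σ j)⁻¹) *
        (U.transpose * U) * Matrix.diagonal σ * V.transpose := by
        simp only [Matrix.mul_assoc]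
    _ = U * (Matrix.diagonal σ * Matrix.diagonal (fun j => (σ j)⁻¹) * Matrix.diagonal σ) *
        V.transpose := by
        rw [hU, hV]; simp only [Matrix.mul_assoc, Matrix.mul_one]
    _ = _ := by rw [e]

variable {m s : ℕ} {S : Finset (Finset (Fin m))} {θ : ℝ} {b : Fin s → Finset (Fin m)}

theorem secondMoment_eq {a : Finset (Fin m) → Fin s → ℝ} {q : Finset (Fin m) → ℝ}
    (ha : ∀ v, q v ≠ 0 → (spannerMatrix b).mulVec (a v) = strategyVec v) :
    secondMoment q = spannerMatrix b * momentMatrix a q * (spannerMatrix b)ᵀ := by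
  rw [secondMoment, momentMatrix, Matrix.mul_sum, Matrix.sum_mul]
  refine Finset.sum_congr rfl fun v _ => ?_
  rcases eq_or_ne (q v) 0 with h0 | h0
  · simp [h0]
  rw [← ha v h0, Matrix.mul_smul, Matrix.smul_mul, Matrix.mul_vecMulVec, Matrix.vecMulVec_mul,
    Matrix.vecMul_transpose]

/-- In the coordinates of the spanner, the pseudoinverse of the second moment matrix is an
inverse. -/
theorem IsSpanner.transpose_mulVec_pseudoinverse (h : IsSpanner S θ b)
    {a : Finset (Fin m) → Fin s → ℝ} {q : Finset (Fin m) → ℝ}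
    (ha : ∀ v, q v ≠ 0 → (spannerMatrix b).mulVec (a v) = strategyVec v)
    (hu : IsUnit (momentMatrix a q)) {P : Matrix (Fin m) (Fin m) ℝ}
    (hP : IsPseudoinverse (secondMoment q) P) (y : Fin s → ℝ) :
    (spannerMatrix b)ᵀ *ᵥ (P *ᵥ (spannerMatrix b *ᵥ y)) = (momentMatrix a q)⁻¹ *ᵥ y := by
  set B := spannerMatrix b
  set W := momentMatrix a q
  -- Since M = B W Bᵀ, a left inverse of B strips the outer factors from M P M = M and leaves W
  -- (BᵀPB) W = W, where W can be cancelled.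
  obtain ⟨L, hL⟩ : ∃ L : Matrix (Fin s) (Fin m) ℝ, L * B = 1 := by
    obtain ⟨g, hg⟩ := LinearMap.exists_leftInverse_of_injective (Matrix.toLin' B)
      (LinearMap.ker_eq_bot.2 h.mulVec_injective)
    refine ⟨LinearMap.toMatrix' g, ?_⟩
    have := congrArg LinearMap.toMatrix' hg
    rwa [LinearMap.toMatrix'_comp, LinearMap.toMatrix'_toLin', LinearMap.toMatrix'_id] at this
  have hLt : Bᵀ * Lᵀ = 1 := by rw [← Matrix.transpose_mul, hL, Matrix.transpose_one]
  have h1 := hP.mul_mul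
  rw [secondMoment_eq ha] at h1
  have h2 : W * (Bᵀ * P * B) * W = W := by
    calc _ = (L * B) * W * (Bᵀ * P * B) * W * (Bᵀ * Lᵀ) := by
          rw [hL, hLt]; simp only [Matrix.mul_one, Matrix.one_mul]
      _ = L * (B * W * Bᵀ * P * (B * W * Bᵀ)) * Lᵀ := by simp only [Matrix.mul_assoc]
      _ = L * (B * W * Bᵀ) * Lᵀ := by rw [h1]
      _ = (L * B) * W * (Bᵀ * Lᵀ) := by simp only [Matrix.mul_assoc]
      _ = W := by rw [hL, hLt]; simp only [Matrix.mul_one, Matrix.one_mul]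
  have hd := (Matrix.isUnit_iff_isUnit_det _).1 hu
  have h3 : Bᵀ * P * B = W⁻¹ := by
    generalize Bᵀ * P * B = X at h2
    calc X = W⁻¹ * (W * X * W) * W⁻¹ := by
          rw [Matrix.mul_assoc W, ← Matrix.mul_assoc W⁻¹, Matrix.nonsing_inv_mul _ hd,
            Matrix.one_mul, Matrix.mul_assoc, Matrix.mul_nonsing_inv _ hd, Matrix.mul_one]
      _ = W⁻¹ := by rw [h2, Matrix.nonsing_inv_mul _ hd, Matrix.one_mul]
  rw [Matrix.mulVec_mulVec, Matrix.mulVec_mulVec, ← h3]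

end Pseudoinverse

/-! ### The exploration distribution. -/

section Law

variable {m s : ℕ} {S : Finset (Finset (Fin m))} {θ : ℝ} {b : Fin s → Finset (Fin m)} {μ : ℝ}
  {q : Finset (Fin m) → ℝ}

theorem IsCaratheodoryDistribution.sum_mul {x : Fin m → ℝ}
    (h : IsCaratheodoryDistribution S b μ x q) :
    ∃ (v : Fin (m + 1) → Finset (Fin m)) (w : Fin (m + 1) → ℝ),
      IsCaratheodoryDecomposition S
        ((1 - μ)⁻¹ • (x - (μ / (s : ℝ)) • ∑ k, strategyVec (b k))) v w ∧
      ∀ f : Finset (Fin m) → ℝ, ∑ u, q u * f u =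
        (1 - μ) * (∑ j, w j * f (v j)) + μ / s * ∑ k, f (b k) := by
  obtain ⟨v, w, h1, h2⟩ := h
  refine ⟨v, w, h1, fun f => ?_⟩
  simp_rw [h2, add_mul, Finset.sum_add_distrib, mul_assoc, ← Finset.mul_sum, Finset.sum_mul]
  congr 1
  · rw [Finset.sum_comm]
    congr 1
    exact Finset.sum_congr rfl fun j _ => by simp
  · rw [Finset.sum_comm]
    congr 1
    exact Finset.sum_congr rfl fun j _ => by simp

theorem IsCaratheodoryDistribution.eq_zero {x : Fin m → ℝ}
    (h : IsCaratheodoryDistribution S b μ x q) (hb : IsSpanner S θ b) {u : Finset (Fin m)}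
    (hu : u ∉ S) : q u = 0 := by
  obtain ⟨v, w, h1, h2⟩ := h
  rw [h2, Finset.sum_eq_zero, Finset.sum_eq_zero]
  · simp
  · intro k _
    rw [if_neg]
    rintro rfl
    exact hu (hb.mem k)
  · intro j _
    rw [if_neg]
    rintro rfl
    exact hu (h1.mem j)

/-- The spanner has unit vectors as coordinates, so its uniform draw alone contributes (μ/s)·1 to
the second moment. The mean is computed in resource space and pulled back through the injective B.
-/
theorem IsCaratheodoryDistribution.isExploring {z : Fin s → ℝ}
    (h : IsCaratheodoryDistribution S b μ ((spannerMatrix b).mulVec z) q)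
    (hb : IsSpanner S θ b) (hs : 0 < s) (hμ : 0 < μ) (hμ1 : μ < 1)
    {a : Finset (Fin m) → Fin s → ℝ}
    (ha : ∀ v ∈ S, (spannerMatrix b).mulVec (a v) = strategyVec v)
    (hab : ∀ k, a (b k) = Pi.single k 1) : IsExploring a q μ z := by
  have hs' : (0 : ℝ) < s := by exact_mod_cast hs
  have hμ2 : 0 < 1 - μ := by linarith
  have hz : ∀ u, u ∉ S → q u = 0 := fun u hu => h.eq_zero hb hu
  obtain ⟨v, w, h1, h2⟩ := h.sum_mul
  have hmono : ∀ f : Finset (Fin m) → ℝ, (∀ u, 0 ≤ f u) →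
      μ / s * ∑ k, f (b k) ≤ ∑ u, q u * f u := by
    intro f hf
    rw [h2 f]
    have : 0 ≤ (1 - μ) * ∑ j, w j * f (v j) :=
      mul_nonneg hμ2.le (Finset.sum_nonneg fun j _ => mul_nonneg (h1.nonneg j) (hf _))
    linarith
  refine ⟨fun u => ?_, ?_, ?_, fun y => ?_⟩
  -- Testing the lower bound on the indicator of a single strategy gives nonnegativity of its
  -- weight.
  · have := hmono (fun u' => if u' = u then 1 else 0) (fun u' => by split_ifs <;> norm_num)
    simp only [mul_ite, mul_one, mul_zero, Finset.sum_ite_eq', Finset.mem_univ, if_true] at this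
    refine le_trans (mul_nonneg (by positivity) (Finset.sum_nonneg fun k _ => ?_)) this
    split_ifs <;> norm_num
  · have := h2 fun _ => 1
    simp only [mul_one, h1.sum_eq_one] at this
    rw [this]
    simp
    field_simp
    ring
  · have hvec : ∑ u, q u • strategyVec u = (spannerMatrix b).mulVec z := by
      ext e
      have e1 := congrFun h1.eq e
      have e2 := h2 fun u => strategyVec u e
      simp only [Finset.sum_apply, Pi.smul_apply, smul_eq_mul, Pi.sub_apply] at e1 ⊢
      rw [e2, ← e1]
      field_simp
      ring
    have hmean : ∑ u, q u • a u = z := by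
      apply hb.mulVec_injective
      rw [← hvec, Matrix.mulVec_sum]
      refine Finset.sum_congr rfl fun u _ => ?_
      rw [Matrix.mulVec_smul]
      by_cases hu : u ∈ S
      · rw [ha u hu]
      · simp [hz u hu]
    intro y
    rw [← hmean, sum_dotProduct]
    exact Finset.sum_congr rfl fun u _ => by rw [smul_dotProduct, smul_eq_mul]
  · refine le_trans (le_of_eq ?_) (hmono (fun u => (a u ⬝ᵥ y) ^ 2) fun u => sq_nonneg _)
    congr 1
    refine Finset.sum_congr rfl fun k _ => ?_
    rw [hab, single_one_dotProduct, sq]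

end Law

/-! ### Euclidean projections and weighted telescoping. -/

section Projection

variable {s : ℕ}

theorem dotProduct_sub_self (u w : Fin s → ℝ) :
    (u - w) ⬝ᵥ (u - w) = u ⬝ᵥ u - 2 * (u ⬝ᵥ w) + w ⬝ᵥ w := by
  rw [sub_dotProduct, dotProduct_sub, dotProduct_sub, dotProduct_comm w u]; ring

/-- A Euclidean projection onto a convex set does not increase distances to its points. -/
theorem IsProjection.sq_dist_le {D : Set (Fin s → ℝ)} (hD : Convex ℝ D) {y x z : Fin s → ℝ}
    (h : IsProjection D y x) (hz : z ∈ D) :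
    (x - z) ⬝ᵥ (x - z) ≤ (y - z) ⬝ᵥ (y - z) := by
  obtain ⟨hx, hmin⟩ := h
  have hmin' : ∀ z ∈ D, (y - x) ⬝ᵥ (y - x) ≤ (y - z) ⬝ᵥ (y - z) := by
    intro z hz
    simpa [dotProduct, sq] using hmin z hz
  have key : ∀ l : ℝ, 0 < l → l ≤ 1 →
      2 * ((y - x) ⬝ᵥ (z - x)) ≤ l * ((z - x) ⬝ᵥ (z - x)) := by
    intro l hl hl1
    have hm : (1 - l) • x + l • z ∈ D := hD hx hz (by linarith) hl.le (by ring)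
    have h1 := hmin' _ hm
    have e : y - ((1 - l) • x + l • z) = (y - x) - l • (z - x) := by
      ext k; simp; ring
    rw [e, dotProduct_sub_self (y - x) (l • (z - x)), dotProduct_smul, smul_dotProduct,
      dotProduct_smul] at h1
    simp only [smul_eq_mul] at h1
    have h2 : l * (2 * ((y - x) ⬝ᵥ (z - x))) ≤ l * (l * ((z - x) ⬝ᵥ (z - x))) := by linarith
    exact le_of_mul_le_mul_left h2 hl
  have hle : (y - x) ⬝ᵥ (z - x) ≤ 0 := by
    by_contra hcon
    push Not at hcon
    have hN := dotProduct_self_nonneg_real (z - x)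
    set N := (z - x) ⬝ᵥ (z - x)
    set I := (y - x) ⬝ᵥ (z - x)
    -- If I > 0, this step length is admissible and satisfies lN ≤ I, contradicting 2I ≤ lN.
    have h1 := key (I / (I + N)) (by positivity) (by rw [div_le_one (by positivity)]; linarith)
    have h2 : I / (I + N) * N ≤ I := by
      rw [div_mul_eq_mul_div, div_le_iff₀ (by positivity)]
      nlinarith
    linarith
  have e : y - z = (y - x) - (z - x) := by abel
  have e' : x - z = -(z - x) := by abel
  rw [e, e', neg_dotProduct, dotProduct_neg, neg_neg, dotProduct_sub_self (y - x) (z - x)]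
  linarith [dotProduct_self_nonneg_real (y - x)]

theorem IsProjection.regret_step {D : Set (Fin s → ℝ)} (hD : Convex ℝ D)
    {x x' z g : Fin s → ℝ} {γ : ℝ} (h : IsProjection D (x - γ • g) x') (hz : z ∈ D) :
    2 * γ * (g ⬝ᵥ (x - z)) ≤
      (x - z) ⬝ᵥ (x - z) - (x' - z) ⬝ᵥ (x' - z) + γ ^ 2 * (g ⬝ᵥ g) := by
  have h1 := h.sq_dist_le hD hz
  have e : x - γ • g - z = (x - z) - γ • g := by abel
  rw [e, dotProduct_sub_self (x - z) (γ • g), dotProduct_smul, smul_dotProduct,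
    dotProduct_smul, dotProduct_comm (x - z) g] at h1
  simp only [smul_eq_mul] at h1
  linarith

/-- Abel summation for the increasing weights 1/(2γ_t). Keeping the term -Φ(T + 1) on the right is
what makes the induction close. -/
theorem sum_weighted_telescope_le {w Φ : ℕ → ℝ} {D : ℝ} {T : ℕ} (hT : 1 ≤ T)
    (hw : ∀ t, 1 ≤ t → w t ≤ w (t + 1)) (hw0 : 0 ≤ w 1) (hΦ : ∀ t ∈ Finset.Icc 1 T, Φ t ≤ D) :
    ∑ t ∈ Finset.Icc 1 T, w t * (Φ t - Φ (t + 1)) ≤ w T * (D - Φ (T + 1)) := by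
  induction T, hT using Nat.le_induction with
  | base =>
    simp only [Finset.Icc_self, Finset.sum_singleton]
    exact mul_le_mul_of_nonneg_left (by linarith [hΦ 1 (by simp)]) hw0
  | succ k hk ih =>
    have h1 := ih fun t ht => hΦ t (Finset.Icc_subset_Icc_right (by omega) ht)
    rw [Finset.sum_Icc_succ_top (by omega)]
    have h2 := hΦ (k + 1) (Finset.mem_Icc.2 ⟨by omega, le_rfl⟩)
    have h3 := mul_le_mul_of_nonneg_right (hw k hk) (sub_nonneg.2 h2)
    linarith

end Projection

/-! ### Gradient descent on the bounded-away polytopes. -/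

section Polytope

variable {m s : ℕ} {S : Finset (Finset (Fin m))} {θ : ℝ} {b : Fin s → Finset (Fin m)} {μ ν : ℝ}

theorem convex_basisPolytope : Convex ℝ (basisPolytope S θ b) := by
  intro x hx y hy u v hu hv huv
  refine ⟨fun k => ?_, ?_⟩
  · exact (convex_Icc (-θ) θ) (hx.1 k) (hy.1 k) hu hv huv
  · rw [Matrix.mulVec_add, Matrix.mulVec_smul, Matrix.mulVec_smul]
    exact (convex_convexHull ℝ _) hx.2 hy.2 hu hv huv

theorem IsSpanner.uniform_mem (hb : IsSpanner S θ b) (hs : 0 < s) (hθ : 1 ≤ θ) :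
    (fun _ => 1 / (s : ℝ)) ∈ basisPolytope S θ b := by
  have hs' : (0 : ℝ) < s := by exact_mod_cast hs
  have h1 : 1 / (s : ℝ) ≤ 1 := by
    rw [div_le_one hs']; exact_mod_cast hs
  have h0 : 0 ≤ 1 / (s : ℝ) := by positivity
  refine ⟨fun k => ⟨by linarith, by linarith⟩, ?_⟩
  rw [spannerMatrix_mulVec]
  refine (convex_convexHull ℝ _).sum_mem (fun _ _ => h0) ?_ fun k _ => strategyVec_mem (hb.mem k)
  simp
  field_simp

theorem convex_boundedAwayPolytope : Convex ℝ (boundedAwayPolytope S θ b μ) := by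
  rintro _ ⟨x, hx, rfl⟩ _ ⟨y, hy, rfl⟩ u v hu hv huv
  refine ⟨u • x + v • y, convex_basisPolytope hx hy hu hv huv, ?_⟩
  ext k
  simp only [Pi.add_apply, Pi.smul_apply, smul_eq_mul]
  have : v = 1 - u := by linarith
  subst this
  ring

/-- All these polytopes contract towards the same point (1/s)𝟙, which lies in the basis polytope.
Hence they grow as μ decreases, and the comparator of round t is still admissible for the projection
onto the polytope of round t + 1. -/
theorem IsSpanner.boundedAwayPolytope_subset (hb : IsSpanner S θ b) (hs : 0 < s) (hθ : 1 ≤ θ)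
    (hνμ : ν ≤ μ) (hν : ν < 1) (hμ : μ ≤ 1) :
    boundedAwayPolytope S θ b μ ⊆ boundedAwayPolytope S θ b ν := by
  have hs' : (s : ℝ) ≠ 0 := by exact_mod_cast hs.ne'
  have hν' : (1 - ν) ≠ 0 := by linarith
  have hν2 : 0 < 1 - ν := by linarith
  rintro _ ⟨x, hx, rfl⟩
  refine ⟨((1 - μ) / (1 - ν)) • x + ((μ - ν) / (1 - ν)) • fun _ => 1 / (s : ℝ),
    convex_basisPolytope hx (hb.uniform_mem hs hθ) (div_nonneg (by linarith) hν2.le)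
      (div_nonneg (by linarith) hν2.le) (by field_simp; ring), ?_⟩
  ext k
  simp only [Pi.add_apply, Pi.smul_apply, smul_eq_mul]
  field_simp
  ring

theorem IsSpanner.abs_le_of_mem_boundedAway (hb : IsSpanner S θ b) (hs : 0 < s) (hθ : 1 ≤ θ)
    (hμ0 : 0 ≤ μ) (hμ : μ ≤ 1) {x : Fin s → ℝ} (hx : x ∈ boundedAwayPolytope S θ b μ)
    (k : Fin s) : |x k| ≤ θ := by
  obtain ⟨z, hz, rfl⟩ := hb.boundedAwayPolytope_subset hs hθ hμ0 one_pos hμ hx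
  simpa [abs_le] using hz.1 k

theorem abs_comparator_sub_le {θ : ℝ} (hθ : 1 ≤ θ) (hs : 0 < s) {a : Fin s → ℝ}
    (ha : ∀ k, |a k| ≤ θ) (k : Fin s) : |a k - 1 / s| ≤ 2 * θ := by
  have hs' : (0 : ℝ) < s := by exact_mod_cast hs
  have h1 : 1 / (s : ℝ) ≤ 1 := by
    rw [div_le_one hs']; exact_mod_cast hs
  have h0 : 0 ≤ 1 / (s : ℝ) := by positivity
  have := abs_le.1 (ha k)
  rw [abs_le]
  constructor <;> linarith [this.1, this.2]

/-- The point of the bounded-away polytope next to the point `a` of the basis polytope. -/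
noncomputable def shrink {s : ℕ} (μ : ℝ) (a : Fin s → ℝ) : Fin s → ℝ :=
  (1 - μ) • a + fun _ => μ / (s : ℝ)

/-- Moving the comparator with the exploration parameter. -/
theorem sq_dist_shrink_le {x a : Fin s → ℝ} (hs : 0 < s) (hθ : 1 ≤ θ) (hx : ∀ k, |x k| ≤ θ)
    (ha : ∀ k, |a k| ≤ θ) (hμa : ∀ k, |shrink μ a k| ≤ θ) (hνa : ∀ k, |shrink ν a k| ≤ θ)
    (hνμ : ν ≤ μ) :
    (x - shrink ν a) ⬝ᵥ (x - shrink ν a) ≤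
      (x - shrink μ a) ⬝ᵥ (x - shrink μ a) + 8 * θ ^ 2 * s * (μ - ν) := by
  have key : ∀ k, (x k - shrink ν a k) * (x k - shrink ν a k) ≤
      (x k - shrink μ a k) * (x k - shrink μ a k) + 8 * θ ^ 2 * (μ - ν) := by
    intro k
    have e : (x k - shrink ν a k) * (x k - shrink ν a k) -
        (x k - shrink μ a k) * (x k - shrink μ a k) =
        -((μ - ν) * ((a k - 1 / s) * (2 * x k - shrink ν a k - shrink μ a k))) := by
      simp only [shrink, Pi.add_apply, Pi.smul_apply, smul_eq_mul]; ring
    have h1 := abs_comparator_sub_le hθ hs ha k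
    have h2 : |2 * x k - shrink ν a k - shrink μ a k| ≤ 4 * θ := by
      have := abs_le.1 (hx k)
      have := abs_le.1 (hμa k)
      have := abs_le.1 (hνa k)
      rw [abs_le]; constructor <;> linarith
    have h3 : |(a k - 1 / s) * (2 * x k - shrink ν a k - shrink μ a k)| ≤ 2 * θ * (4 * θ) := by
      rw [abs_mul]
      exact mul_le_mul h1 h2 (abs_nonneg _) (by linarith)
    have h4 := mul_le_mul_of_nonneg_left (abs_le.1 h3).1 (sub_nonneg.2 hνμ)
    linarith
  have := Finset.sum_le_sum fun k (_ : k ∈ Finset.univ) => key k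
  rw [Finset.sum_add_distrib] at this
  simp only [Finset.sum_const, Finset.card_univ, Fintype.card_fin, nsmul_eq_mul] at this
  simp only [dotProduct, Pi.sub_apply]
  linarith

/-- The regret of projected gradient descent on the bounded-away polytopes. -/
theorem IsSpanner.sum_gradient_le (hb : IsSpanner S θ b) (hs : 0 < s) (hθ : 1 ≤ θ) {T : ℕ}
    (hT : 1 ≤ T) {μ γ : ℕ → ℝ} (hμ0 : ∀ t, 1 ≤ t → 0 ≤ μ t) (hμ : ∀ t, μ t ≤ 1 / 2)
    (hμa : ∀ t, 1 ≤ t → μ (t + 1) ≤ μ t) (hγ : ∀ t, 1 ≤ t → 0 < γ t)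
    (hγa : ∀ t, 1 ≤ t → γ (t + 1) ≤ γ t) {x g : ℕ → Fin s → ℝ}
    (hx : x 1 ∈ boundedAwayPolytope S θ b (μ 1))
    (hup : ∀ t ∈ Finset.Icc 1 T, IsProjection (boundedAwayPolytope S θ b (μ (t + 1)))
      (x t - γ t • g t) (x (t + 1))) {a : Fin s → ℝ} (ha : a ∈ basisPolytope S θ b) :
    ∑ t ∈ Finset.Icc 1 T, g t ⬝ᵥ (x t - shrink (μ t) a) ≤
      4 * θ ^ 2 * s / γ T + ∑ t ∈ Finset.Icc 1 T, γ t / 2 * (g t ⬝ᵥ g t) := by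
  have hs' : (0 : ℝ) < s := by exact_mod_cast hs
  have haθ : ∀ k, |a k| ≤ θ := fun k => abs_le.2 (ha.1 k)
  have hamem : ∀ t, shrink (μ t) a ∈ boundedAwayPolytope S θ b (μ t) := fun t => ⟨a, ha, rfl⟩
  have hmem : ∀ t, 1 ≤ t → t ≤ T + 1 → x t ∈ boundedAwayPolytope S θ b (μ t) := by
    intro t h1 h2
    rcases h1.eq_or_lt with rfl | h3
    · exact hx
    · have := (hup (t - 1) (Finset.mem_Icc.2 ⟨by omega, by omega⟩)).1
      rwa [Nat.sub_add_cancel h1] at this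
  have habs : ∀ t, 1 ≤ t → ∀ z ∈ boundedAwayPolytope S θ b (μ t), ∀ k, |z k| ≤ θ :=
    fun t h1 z hz => hb.abs_le_of_mem_boundedAway hs hθ (hμ0 t h1) (by linarith [hμ t]) hz
  -- The added term 8θ²sμ_t pays for the motion of the comparator: its decrease from t to t + 1
  -- covers the error in `sq_dist_shrink_le`.
  set Φ : ℕ → ℝ := fun t => (x t - shrink (μ t) a) ⬝ᵥ (x t - shrink (μ t) a) +
    8 * θ ^ 2 * s * μ t with hΦ
  have hstep : ∀ t ∈ Finset.Icc 1 T, g t ⬝ᵥ (x t - shrink (μ t) a) ≤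
      1 / (2 * γ t) * (Φ t - Φ (t + 1)) + γ t / 2 * (g t ⬝ᵥ g t) := by
    intro t ht
    have ht' := Finset.mem_Icc.1 ht
    have hγt := hγ t ht'.1
    have h1 := (hup t ht).regret_step convex_boundedAwayPolytope
      (hb.boundedAwayPolytope_subset hs hθ (hμa t ht'.1) (by linarith [hμ (t + 1)])
        (by linarith [hμ t]) (hamem t))
    have h2 := sq_dist_shrink_le hs hθ
      (habs (t + 1) (by omega) _ (hmem (t + 1) (by omega) (by omega))) haθ
      (habs t ht'.1 _ (hamem t)) (habs (t + 1) (by omega) _ (hamem (t + 1))) (hμa t ht'.1)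
    have h3 : 2 * γ t * (g t ⬝ᵥ (x t - shrink (μ t) a)) ≤
        Φ t - Φ (t + 1) + γ t ^ 2 * (g t ⬝ᵥ g t) := by
      simp only [hΦ]; linarith
    have h4 : g t ⬝ᵥ (x t - shrink (μ t) a) ≤
        (Φ t - Φ (t + 1) + γ t ^ 2 * (g t ⬝ᵥ g t)) / (2 * γ t) := by
      rw [le_div_iff₀ (by positivity)]; linarith
    refine h4.trans (le_of_eq ?_)
    field_simp
  -- 4θ²s from the diameter, and another 4θ²s from the added term because μ_t ≤ 1/2.
  have hbound : ∀ t ∈ Finset.Icc 1 T, Φ t ≤ 8 * θ ^ 2 * s := by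
    intro t ht
    have ht' := Finset.mem_Icc.1 ht
    have h1 : (x t - shrink (μ t) a) ⬝ᵥ (x t - shrink (μ t) a) ≤ s * (2 * θ) ^ 2 := by
      refine dotProduct_self_le_of_abs_le fun k => ?_
      have h2 := abs_le.1 (habs t ht'.1 _ (hmem t ht'.1 (by omega)) k)
      have h3 := abs_le.1 (habs t ht'.1 _ (hamem t) k)
      rw [Pi.sub_apply, abs_le]
      constructor <;> linarith
    have h2 := mul_le_mul_of_nonneg_left (hμ t) (by positivity : 0 ≤ 8 * θ ^ 2 * (s : ℝ))
    simp only [hΦ]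
    nlinarith
  have htel := sum_weighted_telescope_le (w := fun t => 1 / (2 * γ t)) hT
    (fun t ht => one_div_le_one_div_of_le (by linarith [hγ (t + 1) (by omega)])
      (by linarith [hγa t ht])) (by have := hγ 1 le_rfl; positivity) hbound
  have hlast : 0 ≤ Φ (T + 1) := by
    have := hμ0 (T + 1) (by omega)
    have := dotProduct_self_nonneg_real (x (T + 1) - shrink (μ (T + 1)) a)
    simp only [hΦ]; positivity
  have hγT := hγ T hT
  have h5 : 1 / (2 * γ T) * (8 * θ ^ 2 * s - Φ (T + 1)) ≤ 4 * θ ^ 2 * s / γ T := by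
    have : 0 ≤ 1 / (2 * γ T) * Φ (T + 1) := by positivity
    have e : 1 / (2 * γ T) * (8 * θ ^ 2 * s) = 4 * θ ^ 2 * s / γ T := by field_simp; norm_num
    linarith
  have := Finset.sum_le_sum hstep
  rw [Finset.sum_add_distrib] at this
  linarith

end Polytope

/-! ### Positivity and monotonicity of the parameters. -/

section Parameters

variable {n m : ℕ} {cmax θ : ℝ}

theorem bias_pos (hn : 1 ≤ n) (hm : 1 ≤ m) (hc : 0 < cmax) {t : ℕ} (ht : 1 ≤ t) :
    0 < bias n m cmax t := by
  have : (0 : ℝ) < n := by exact_mod_cast hn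
  have : (0 : ℝ) < m := by exact_mod_cast hm
  have : (0 : ℝ) < t := by exact_mod_cast ht
  exact lt_min (by positivity) (by norm_num)

theorem bias_le_half (n m : ℕ) (cmax : ℝ) (t : ℕ) : bias n m cmax t ≤ 1 / 2 := min_le_right _ _

theorem bias_anti (hm : 1 ≤ m) (hc : 0 < cmax) {t r : ℕ} (ht : 1 ≤ t) (htr : t ≤ r) :
    bias n m cmax r ≤ bias n m cmax t := by
  have : (0 : ℝ) < m := by exact_mod_cast hm
  have h1 : (0 : ℝ) < t := by exact_mod_cast ht
  have h2 : (t : ℝ) ≤ r := by exact_mod_cast htr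
  refine min_le_min_right _ ?_
  gcongr

theorem stepSize_pos (hθ : 1 ≤ θ) (hn : 1 ≤ n) (hm : 1 ≤ m) (hc : 0 < cmax) {t : ℕ}
    (ht : 1 ≤ t) : 0 < stepSize θ n m cmax t := by
  have : (0 : ℝ) < n := by exact_mod_cast hn
  have : (0 : ℝ) < m := by exact_mod_cast hm
  have : (0 : ℝ) < t := by exact_mod_cast ht
  have := bias_pos hn hm hc ht
  exact Real.sqrt_pos.2 (by positivity)

theorem stepSize_anti (hθ : 1 ≤ θ) (hn : 1 ≤ n) (hm : 1 ≤ m) (hc : 0 < cmax) {t r : ℕ}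
    (ht : 1 ≤ t) (htr : t ≤ r) : stepSize θ n m cmax r ≤ stepSize θ n m cmax t := by
  have : (0 : ℝ) < n := by exact_mod_cast hn
  have : (0 : ℝ) < m := by exact_mod_cast hm
  have : (0 : ℝ) < t := by exact_mod_cast ht
  have : (t : ℝ) ≤ r := by exact_mod_cast htr
  have h1 := bias_pos hn hm hc ht
  have h2 := bias_anti (n := n) hm hc ht htr
  refine Real.sqrt_le_sqrt ?_
  gcongr

end Parameters

/-! ### Measurability of the estimator. -/

section Measurability

open Matrix

variable {Ω : Type*} {𝓖 : MeasurableSpace Ω} {s : ℕ}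

theorem measurable_det {A : Ω → Matrix (Fin s) (Fin s) ℝ}
    (hA : ∀ i j, Measurable fun ω => A ω i j) : Measurable fun ω => (A ω).det := by
  simp only [Matrix.det_apply]
  refine Finset.measurable_sum _ fun σ _ => ?_
  exact (Finset.measurable_prod _ fun i _ => hA _ _).const_smul _

/-- Cramer's rule: entries of the inverse are determinants times the inverse of a determinant, with
the convention 0⁻¹ = 0 covering singular matrices. -/
theorem measurable_inv_apply {A : Ω → Matrix (Fin s) (Fin s) ℝ}
    (hA : ∀ i j, Measurable fun ω => A ω i j) (i j : Fin s) :
    Measurable fun ω => (A ω)⁻¹ i j := by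
  simp only [Matrix.inv_def, Ring.inverse_eq_inv', Matrix.smul_apply, smul_eq_mul,
    Matrix.adjugate_apply]
  refine (measurable_det hA).inv.mul (measurable_det fun k l => ?_)
  simp only [Matrix.updateRow_apply]
  split_ifs
  · exact measurable_const
  · exact hA k l

theorem measurable_dotProduct {y z : Ω → Fin s → ℝ} (hy : ∀ k, Measurable fun ω => y ω k)
    (hz : ∀ k, Measurable fun ω => z ω k) : Measurable fun ω => y ω ⬝ᵥ z ω :=
  Finset.measurable_sum _ fun k _ => (hy k).mul (hz k)

theorem measurable_gradEstimate {V : Type*} [Fintype V] {a : V → Fin s → ℝ} {q : Ω → V → ℝ}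
    {h : Ω → Fin s → ℝ} (hq : ∀ v, Measurable fun ω => q ω v)
    (hh : ∀ k, Measurable fun ω => h ω k) (v : V) (k : Fin s) :
    Measurable fun ω => gradEstimate a (q ω) (h ω) v k := by
  simp only [gradEstimate, Pi.smul_apply, smul_eq_mul]
  refine (measurable_dotProduct (z := fun _ => a v) hh fun _ => measurable_const).mul ?_
  refine measurable_dotProduct (z := fun _ => a v) (fun l => measurable_inv_apply (fun i j => ?_) k l)
    fun _ => measurable_const
  simp only [momentMatrix_apply]
  exact Finset.measurable_sum _ fun v _ => (hq v).mul measurable_const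

end Measurability

/-! ### The random part of the one-round regret. -/

section Excess

variable {V : Type*} [Fintype V] {s : ℕ}

/-- The cost of playing `v`, minus its linearized estimate, plus the gradient penalty. -/
noncomputable def excess (a : V → Fin s → ℝ) (q : V → ℝ) (h z : Fin s → ℝ) (γ : ℝ) (v : V) : ℝ :=
  h ⬝ᵥ a v - gradEstimate a q h v ⬝ᵥ z +
    γ / 2 * (gradEstimate a q h v ⬝ᵥ gradEstimate a q h v)

variable {a : V → Fin s → ℝ} {q : V → ℝ} {μ γ G θ : ℝ} {x h z : Fin s → ℝ}

/-- Applied with z = x - u_t, so that h·(x - z) is the cost of the comparator. Bundling the cost,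
the linear estimate and the penalty means that a single martingale controls all three. -/
theorem IsExploring.mean_excess_le (hE : IsExploring a q μ x) (hμ : 0 < μ) (hs : 0 < s)
    (hγ : 0 ≤ γ) (hG : ∀ v, |h ⬝ᵥ a v| ≤ G) :
    ∑ v, q v * excess a q h z γ v ≤ h ⬝ᵥ (x - z) + γ / 2 * (G ^ 2 * (s ^ 2 / μ)) := by
  have h1 := hE.mean h
  have h2 := hE.mean_gradEstimate hμ hs h z
  have h3 := hE.mean_sq_gradEstimate_le hμ hs (c := h) (fun v _ => hG v)
  have e : ∑ v, q v * excess a q h z γ v = ∑ v, q v * (a v ⬝ᵥ h) -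
      ∑ v, q v * (gradEstimate a q h v ⬝ᵥ z) +
      γ / 2 * ∑ v, q v * (gradEstimate a q h v ⬝ᵥ gradEstimate a q h v) := by
    rw [Finset.mul_sum, ← Finset.sum_sub_distrib, ← Finset.sum_add_distrib]
    refine Finset.sum_congr rfl fun v _ => ?_
    rw [excess, dotProduct_comm h]; ring
  rw [e, h1, h2, dotProduct_sub, dotProduct_comm x]
  have := mul_le_mul_of_nonneg_left h3 (by linarith : 0 ≤ γ / 2)
  linarith

theorem IsExploring.abs_excess_le (hE : IsExploring a q μ x) (hμ : 0 < μ) (hs : 0 < s)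
    (hγ : 0 ≤ γ) (hG0 : 0 ≤ G) (ha : ∀ v k, |a v k| ≤ θ) (hz : ∀ k, |z k| ≤ 2 * θ)
    (hG : ∀ v, |h ⬝ᵥ a v| ≤ G) (v : V) :
    |excess a q h z γ v| ≤
      G + 2 * θ ^ 2 * s ^ 2 * G / μ + γ / 2 * (G ^ 2 * (s ^ 3 * θ ^ 2 / μ ^ 2)) := by
  have h1 := hE.sq_gradEstimate_le hμ hs ha (hG v)
  have h0 := dotProduct_self_nonneg_real (gradEstimate a q h v)
  have h2 : |gradEstimate a q h v ⬝ᵥ z| ≤ 2 * θ ^ 2 * s ^ 2 * G / μ := by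
    refine abs_le_of_sq_le_sq ?_ (by positivity)
    refine (sq_dotProduct_le _ _).trans ?_
    refine (mul_le_mul h1 (dotProduct_self_le_of_abs_le hz) (dotProduct_self_nonneg_real z)
      (by positivity)).trans (le_of_eq ?_)
    field_simp
  have h3 := mul_le_mul_of_nonneg_left h1 (by linarith : 0 ≤ γ / 2)
  have h4 : 0 ≤ γ / 2 * (gradEstimate a q h v ⬝ᵥ gradEstimate a q h v) := by positivity
  have h5 := abs_le.1 (hG v)
  have h6 := abs_le.1 h2
  rw [excess, abs_le]
  constructor <;> linarith [h5.1, h5.2, h6.1, h6.2]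

end Excess

/-! ### The high-probability regret bound for a run. -/

section Run

open Matrix

variable {Ω : Type*} {mΩ : MeasurableSpace Ω} {P : Measure Ω} {ℱ : Filtration ℕ mΩ}
  {m s : ℕ} {S : Finset (Finset (Fin m))} {θ : ℝ} {b : Fin s → Finset (Fin m)}
  {n : ℕ} {cmax δ : ℝ} {T : ℕ}
  {c : ℕ → Ω → Fin m → ℝ} {α : ℕ → Ω → Fin s → ℝ}
  {q : ℕ → Ω → Finset (Fin m) → ℝ} {p : ℕ → Ω → Finset (Fin m)}

theorem abs_dotProduct_strategyVec_le {c : Fin m → ℝ} (hc0 : 0 ≤ cmax)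
    (hc : ∀ e, |c e| ≤ cmax) (v : Finset (Fin m)) : |c ⬝ᵥ strategyVec v| ≤ m * cmax := by
  refine (Finset.abs_sum_le_sum_abs _ _).trans ?_
  refine (Finset.sum_le_card_nsmul _ _ cmax fun e _ => ?_).trans (by simp)
  rw [strategyVec]
  split_ifs
  · simpa using hc e
  · simpa using hc0

theorem IsRun.regret_le (hrun : IsRun P ℱ S θ b n cmax T c α q p) (hS : S.Nonempty)
    (hc : 0 < cmax) (ω : Ω) :
    regret S hS T (fun t => c t ω) (fun t => p t ω) ≤ 2 * m * cmax * T := by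
  obtain ⟨u, hu, e⟩ := S.exists_mem_eq_inf' hS
    (fun u => ∑ t ∈ Finset.Icc 1 T, c t ω ⬝ᵥ strategyVec u)
  rw [regret, e, ← Finset.sum_sub_distrib]
  refine (Finset.sum_le_card_nsmul _ _ (2 * m * cmax) fun t ht => ?_).trans ?_
  · have h1 := abs_le.1 (abs_dotProduct_strategyVec_le hc.le (hrun.cost_bounded t ht ω) (p t ω))
    have h2 := abs_le.1 (abs_dotProduct_strategyVec_le hc.le (hrun.cost_bounded t ht ω) u)
    linarith [h1.2, h2.1]
  · simp [mul_comm]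

theorem IsRun.point_mem (hrun : IsRun P ℱ S θ b n cmax T c α q p) {t : ℕ}
    (ht : t ∈ Finset.Icc 1 T) (ω : Ω) :
    α t ω ∈ boundedAwayPolytope S θ b (bias n m cmax t) := by
  obtain ⟨h1, h2⟩ := Finset.mem_Icc.1 ht
  rcases h1.eq_or_lt with rfl | h3
  · exact hrun.init ω
  · obtain ⟨_, _, h⟩ := hrun.update (t - 1) (Finset.mem_Icc.2 ⟨by omega, by omega⟩) ω
    have := h.1
    rwa [Nat.sub_add_cancel h1] at this

/-- The probability of playing u is the integral of its conditional law, which vanishes off `S`. -/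
theorem IsRun.ae_play_mem [IsProbabilityMeasure P] (hrun : IsRun P ℱ S θ b n cmax T c α q p)
    (hb : IsSpanner S θ b) : ∀ᵐ ω ∂P, ∀ t ∈ Finset.Icc 1 T, p t ω ∈ S := by
  refine (ae_ball_iff (S := (Finset.Icc 1 T : Set ℕ)) (Finset.countable_toSet _)).2 ?_
  intro t ht
  have h1 : ∀ u, u ∉ S → ∀ᵐ ω ∂P, p t ω ≠ u := by
    intro u hu
    have hmeas : MeasurableSet {ω | p t ω = u} := ℱ.le _ _ (hrun.play_adapted t ht u)
    have h2 : ∫ ω, Set.indicator {ω | p t ω = u} (fun _ => (1 : ℝ)) ω ∂P = 0 := by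
      rw [← integral_condExp (ℱ.le t), integral_congr_ae (hrun.sample t ht u)]
      simp [fun ω => (hrun.law t ht ω).eq_zero hb hu]
    rw [integral_indicator_const _ hmeas, smul_eq_mul, mul_one, measureReal_eq_zero_iff] at h2
    rw [ae_iff]
    simpa using h2
  have h2 : ∀ᵐ ω ∂P, ∀ u, u ∉ S → p t ω ≠ u := by
    rw [ae_all_iff]
    intro u
    by_cases hu : u ∈ S
    · exact Filter.Eventually.of_forall fun ω h => absurd hu h
    · filter_upwards [h1 u hu] with ω h _ using h
  filter_upwards [h2] with ω h
  by_contra hcon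
  exact h _ hcon rfl

/-- There are at most 2^m ≤ e^m strategies. The exponent supplies e^{-m} to pay for them, and the
remaining δ^m is at most δ. -/
theorem card_mul_exp_le {S : Finset (Finset (Fin m))} (hm : 1 ≤ m) (hδ : 0 < δ) (hδ1 : δ < 1) :
    (S.card : ℝ) * Real.exp (-(m * (1 + Real.log (1 / δ)))) ≤ δ := by
  have hm' : (1 : ℝ) ≤ m := by exact_mod_cast hm
  have h1 : (S.card : ℝ) ≤ 2 ^ m := by
    have : S.card ≤ 2 ^ m := by simpa using S.card_le_univ
    exact_mod_cast this
  have h2 : (2 : ℝ) ^ m ≤ Real.exp m := by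
    rw [← Real.exp_one_pow]
    exact pow_le_pow_left₀ (by norm_num) (by linarith [Real.add_one_le_exp (1 : ℝ)]) _
  have h3 : Real.log δ ≤ 0 := Real.log_nonpos hδ.le hδ1.le
  have h4 : Real.exp (-(m * (1 + Real.log (1 / δ)))) ≤ Real.exp (-m) * δ := by
    conv_rhs => rw [← Real.exp_log hδ]
    rw [← Real.exp_add, one_div, Real.log_inv]
    exact Real.exp_le_exp.2 (by nlinarith)
  calc _ ≤ Real.exp m * (Real.exp (-m) * δ) :=
        mul_le_mul (h1.trans h2) h4 (Real.exp_pos _).le (Real.exp_pos _).le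
    _ = δ := by rw [← mul_assoc, ← Real.exp_add]; simp

/-- A bound for the martingale differences of the regret. -/
noncomputable def deviation (θ : ℝ) (n m : ℕ) (cmax : ℝ) (t : ℕ) : ℝ :=
  6 * θ ^ 2 * m ^ 3 * cmax / bias n m cmax t +
    stepSize θ n m cmax t * θ ^ 2 * m ^ 5 * cmax ^ 2 / bias n m cmax t ^ 2

/-- The descent inequality and the excess contain the same terms g·(x - u_t) and γ/2 |g|² with
opposite signs, so these cancel; only the step-size term, the conditional means and the Azuma
deviation remain. -/
theorem IsRun.regret_high_probability [IsProbabilityMeasure P]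
    (hrun : IsRun P ℱ S θ b n cmax T c α q p) (hS : S.Nonempty) (hθ : 1 ≤ θ) (hn : 1 ≤ n)
    (hT : 1 ≤ T) (hne : ∃ u ∈ S, u.Nonempty) (hb : IsSpanner S θ b) (hc : 0 < cmax)
    (hδ : 0 < δ) (hδ1 : δ < 1) :
    1 - δ ≤ P.real {ω | regret S hS T (fun t => c t ω) (fun t => p t ω) ≤
      4 * θ ^ 2 * m / stepSize θ n m cmax T +
      ∑ t ∈ Finset.Icc 1 T, (stepSize θ n m cmax t / 2 * (m ^ 4 * cmax ^ 2 / bias n m cmax t) +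
        2 * m * cmax * bias n m cmax t) +
      Real.sqrt (2 * (∑ t ∈ Finset.Icc 1 T, deviation θ n m cmax t ^ 2) *
        (m * (1 + Real.log (1 / δ))))} := by
  have hs := hb.card_pos hne
  have hsm := hb.card_le
  have hm : 1 ≤ m := by omega
  have hs' : (1 : ℝ) ≤ s := by exact_mod_cast hs
  have hm' : (1 : ℝ) ≤ m := by exact_mod_cast hm
  have hsm' : (s : ℝ) ≤ m := by exact_mod_cast hsm
  obtain ⟨a, ha, ha0, haθ, hab⟩ := hb.exists_coords hθ
  set μ := bias n m cmax
  set γ := stepSize θ n m cmax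
  have hμ : ∀ t, 1 ≤ t → 0 < μ t := fun t ht => bias_pos hn hm hc ht
  have hμh : ∀ t, μ t ≤ 1 / 2 := bias_le_half n m cmax
  have hγ : ∀ t, 1 ≤ t → 0 < γ t := fun t ht => stepSize_pos hθ hn hm hc ht
  set h : ℕ → Ω → Fin s → ℝ := fun t ω => (spannerMatrix b)ᵀ *ᵥ c t ω with hh
  have hcost : ∀ t ω, ∀ v ∈ S, h t ω ⬝ᵥ a v = c t ω ⬝ᵥ strategyVec v := by
    intro t ω v hv
    rw [← ha v hv, Matrix.dotProduct_mulVec, ← Matrix.mulVec_transpose]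
  have hG : ∀ t ∈ Finset.Icc 1 T, ∀ ω v, |h t ω ⬝ᵥ a v| ≤ m * cmax := by
    intro t ht ω v
    by_cases hv : v ∈ S
    · rw [hcost t ω v hv]
      exact abs_dotProduct_strategyVec_le hc.le (hrun.cost_bounded t ht ω) v
    · rw [ha0 v hv, dotProduct_zero, abs_zero]; positivity
  have hE : ∀ t ∈ Finset.Icc 1 T, ∀ ω, IsExploring a (q t ω) (μ t) (α t ω) := fun t ht ω =>
    (hrun.law t ht ω).isExploring hb hs (hμ t (Finset.mem_Icc.1 ht).1)
      (by linarith [hμh t]) ha hab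
  have hamem : ∀ u ∈ S, a u ∈ basisPolytope S θ b := fun u hu =>
    ⟨fun k => abs_le.1 (haθ u k), by rw [ha u hu]; exact strategyVec_mem hu⟩
  have hsh : ∀ u ∈ S, ∀ t, 1 ≤ t → ∀ k, |shrink (μ t) (a u) k| ≤ θ := fun u hu t ht =>
    hb.abs_le_of_mem_boundedAway hs hθ (hμ t ht).le (by linarith [hμh t]) ⟨a u, hamem u hu, rfl⟩
  set Y : Finset (Fin m) → ℕ → Ω → Finset (Fin m) → ℝ := fun u t ω v =>
    excess a (q t ω) (h t ω) (α t ω - shrink (μ t) (a u)) (γ t) v with hY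
  -- Centering at most doubles the bound on `Y`, which is why `Y` is bounded by half of `deviation`.
  set d : Finset (Fin m) → ℕ → Ω → Finset (Fin m) → ℝ := fun u t ω v =>
    Y u t ω v - ∑ w, q t ω w * Y u t ω w with hd
  have hhm : ∀ t ∈ Finset.Icc 1 T, ∀ k, Measurable[ℱ t] fun ω => h t ω k := by
    intro t ht k
    exact measurable_dotProduct (fun _ => measurable_const) (hrun.cost_adapted t ht)
  have hYm : ∀ u, ∀ t ∈ Finset.Icc 1 T, ∀ v, Measurable[ℱ t] fun ω => Y u t ω v := by
    intro u t ht v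
    have hg := measurable_gradEstimate (a := a) (hrun.law_adapted t ht) (hhm t ht) v
    refine ((measurable_dotProduct (z := fun _ => a v) (hhm t ht) fun _ => measurable_const).sub
      (measurable_dotProduct (z := fun ω => α t ω - shrink (μ t) (a u)) hg fun k => ?_)).add
      ((measurable_dotProduct hg hg).const_mul (γ t / 2))
    exact (hrun.point_adapted t ht k).sub_const _
  have hdm : ∀ u, ∀ t ∈ Finset.Icc 1 T, ∀ v, Measurable[ℱ t] fun ω => d u t ω v := by
    intro u t ht v
    exact (hYm u t ht v).sub
      (Finset.measurable_sum _ fun w _ => (hrun.law_adapted t ht w).mul (hYm u t ht w))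
  have hYb : ∀ u ∈ S, ∀ t ∈ Finset.Icc 1 T, ∀ ω v,
      |Y u t ω v| ≤ deviation θ n m cmax t / 2 := by
    intro u hu t ht ω v
    have ht1 := (Finset.mem_Icc.1 ht).1
    have hμt := hμ t ht1
    have hγt := hγ t ht1
    refine ((hE t ht ω).abs_excess_le hμt hs hγt.le (by positivity) haθ
      (fun k => ?_) (hG t ht ω) v).trans ?_
    · have h1 := abs_le.1 (hb.abs_le_of_mem_boundedAway hs hθ hμt.le (by linarith [hμh t])
        (hrun.point_mem ht ω) k)
      have h2 := abs_le.1 (hsh u hu t ht1 k)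
      rw [Pi.sub_apply, abs_le]
      constructor <;> linarith [h1.1, h1.2, h2.1, h2.2]
    · have e1 : (m : ℝ) * cmax ≤ θ ^ 2 * m ^ 3 * cmax / μ t := by
        rw [le_div_iff₀ hμt]
        have h1 : (m : ℝ) * cmax * μ t ≤ m * cmax * 1 :=
          mul_le_mul_of_nonneg_left (by linarith [hμh t]) (by positivity)
        have h2 : (m : ℝ) ≤ θ ^ 2 * m ^ 3 := by
          have h3 : (1 : ℝ) ≤ θ ^ 2 * m ^ 2 :=
            one_le_mul_of_one_le_of_one_le (one_le_pow₀ hθ) (one_le_pow₀ hm')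
          nlinarith
        have h3 := mul_le_mul_of_nonneg_right h2 hc.le
        linarith
      have e2 : 2 * θ ^ 2 * (s : ℝ) ^ 2 * (m * cmax) / μ t ≤
          2 * (θ ^ 2 * m ^ 3 * cmax / μ t) := by
        calc _ ≤ 2 * θ ^ 2 * (m : ℝ) ^ 2 * (m * cmax) / μ t := by gcongr
          _ = _ := by ring
      have e3 : γ t / 2 * ((m * cmax) ^ 2 * ((s : ℝ) ^ 3 * θ ^ 2 / μ t ^ 2)) ≤
          γ t * θ ^ 2 * m ^ 5 * cmax ^ 2 / μ t ^ 2 / 2 := by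
        calc _ ≤ γ t / 2 * ((m * cmax) ^ 2 * ((m : ℝ) ^ 3 * θ ^ 2 / μ t ^ 2)) := by gcongr
          _ = _ := by ring
      have e4 : deviation θ n m cmax t / 2 = 3 * (θ ^ 2 * m ^ 3 * cmax / μ t) +
          γ t * θ ^ 2 * m ^ 5 * cmax ^ 2 / μ t ^ 2 / 2 := by
        rw [deviation]; ring
      rw [e4]
      linarith
  have hdb : ∀ u ∈ S, ∀ t ∈ Finset.Icc 1 T, ∀ ω v, |d u t ω v| ≤ deviation θ n m cmax t := by
    intro u hu t ht ω v
    have h1 := abs_le.1 (hYb u hu t ht ω v)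
    have h2 : |∑ w, q t ω w * Y u t ω w| ≤ deviation θ n m cmax t / 2 := by
      refine (Finset.abs_sum_le_sum_abs _ _).trans ?_
      calc _ ≤ ∑ w, q t ω w * (deviation θ n m cmax t / 2) := by
            refine Finset.sum_le_sum fun w _ => ?_
            rw [abs_mul, abs_of_nonneg ((hE t ht ω).nonneg w)]
            exact mul_le_mul_of_nonneg_left (hYb u hu t ht ω w) ((hE t ht ω).nonneg w)
        _ = _ := by rw [← Finset.sum_mul, (hE t ht ω).sum_eq_one, one_mul]
    have h2 := abs_le.1 h2
    rw [hd, abs_le]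
    constructor <;> simp only <;> linarith [h1.1, h1.2, h2.1, h2.2]
  have hmean : ∀ u, ∀ t ∈ Finset.Icc 1 T, ∀ ω, ∑ v, q t ω v * d u t ω v = 0 := by
    intro u t ht ω
    simp only [hd, mul_sub, Finset.sum_sub_distrib]
    rw [← Finset.sum_mul, (hE t ht ω).sum_eq_one, one_mul, sub_self]
  have hdev : ∀ t ∈ Finset.Icc 1 T, 0 < deviation θ n m cmax t := by
    intro t ht
    have h1 := hμ t (Finset.mem_Icc.1 ht).1
    have h2 := hγ t (Finset.mem_Icc.1 ht).1
    rw [deviation]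
    positivity
  set U := ∑ t ∈ Finset.Icc 1 T, deviation θ n m cmax t ^ 2 with hU
  have hUpos : 0 < U := Finset.sum_pos (fun t ht => pow_pos (hdev t ht) 2)
    ⟨1, Finset.mem_Icc.2 ⟨le_rfl, hT⟩⟩
  have hlog : 0 ≤ Real.log (1 / δ) := Real.log_nonneg (by rw [le_div_iff₀ hδ]; linarith)
  set ε := Real.sqrt (2 * U * (m * (1 + Real.log (1 / δ))))
  set A : Finset (Fin m) → Set Ω := fun u =>
    {ω | ε ≤ ∑ t ∈ Finset.Icc 1 T, d u t ω (p t ω)} with hA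
  have hPA : ∀ u ∈ S, P.real (A u) ≤ Real.exp (-(m * (1 + Real.log (1 / δ)))) := fun u hu =>
    measureReal_sum_ge_le hrun.play_adapted (hdm u) hrun.sample
      (fun t ht ω => (hE t ht ω).nonneg) (fun t ht ω => (hE t ht ω).sum_eq_one) (hmean u) hdev
      (hdb u hu) hUpos (by positivity)
  set N : Set Ω := {ω | ¬ ∀ t ∈ Finset.Icc 1 T, p t ω ∈ S} with hN
  have hPN : P.real N = 0 := by
    rw [measureReal_eq_zero_iff]
    exact ae_iff.1 (hrun.ae_play_mem hb)
  set Good : Set Ω := {ω | regret S hS T (fun t => c t ω) (fun t => p t ω) ≤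
      4 * θ ^ 2 * m / γ T + ∑ t ∈ Finset.Icc 1 T, (γ t / 2 * (m ^ 4 * cmax ^ 2 / μ t) +
        2 * m * cmax * μ t) + ε} with hGood
  -- Outside the Azuma events and the null set the argument is deterministic. The minimizing u
  -- depends on ω, so all u in `S` must be excluded at once.
  have hcover : Set.univ ⊆ Good ∪ ((⋃ u ∈ S, A u) ∪ N) := by
    intro ω _
    by_contra hcon
    simp only [Set.mem_union, Set.mem_iUnion, not_or, not_exists, hN, Set.mem_ofPred_eq,
      not_not] at hcon
    obtain ⟨hbad, hAω, hpS⟩ := hcon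
    refine hbad ?_
    obtain ⟨u, hu, e⟩ := S.exists_mem_eq_inf' hS
      (fun u => ∑ t ∈ Finset.Icc 1 T, c t ω ⬝ᵥ strategyVec u)
    have hsum : ∑ t ∈ Finset.Icc 1 T, d u t ω (p t ω) < ε := not_le.1 (hAω u hu)
    simp only [hGood, Set.mem_ofPred_eq]
    rw [regret, e]
    have hgd := hb.sum_gradient_le hs hθ hT (μ := μ) (γ := γ) (fun t ht => (hμ t ht).le) hμh
      (fun t ht => bias_anti hm hc ht (Nat.le_succ t)) hγ
      (fun t ht => stepSize_anti hθ hn hm hc ht (Nat.le_succ t)) (x := fun t => α t ω)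
      (g := fun t => gradEstimate a (q t ω) (h t ω) (p t ω)) (hrun.init ω)
      (fun t ht => by
        obtain ⟨Mp, hMp, hpr⟩ := hrun.update t ht ω
        have hunit := (hE t ht ω).isUnit (hμ t (Finset.mem_Icc.1 ht).1) hs
        have hinv := hb.transpose_mulVec_pseudoinverse (a := a) (q := q t ω)
          (fun v hv => ha v (by
            by_contra hvS
            exact hv ((hrun.law t ht ω).eq_zero hb hvS))) hunit hMp (a (p t ω))
        rw [ha _ (hpS t ht)] at hinv
        rw [Matrix.mulVec_smul, hinv, ← hcost t ω _ (hpS t ht)] at hpr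
        exact hpr) (hamem u hu)
    have hstep : ∀ t ∈ Finset.Icc 1 T,
        c t ω ⬝ᵥ strategyVec (p t ω) - c t ω ⬝ᵥ strategyVec u ≤
        d u t ω (p t ω) + gradEstimate a (q t ω) (h t ω) (p t ω) ⬝ᵥ
          (α t ω - shrink (μ t) (a u)) -
        γ t / 2 * (gradEstimate a (q t ω) (h t ω) (p t ω) ⬝ᵥ
          gradEstimate a (q t ω) (h t ω) (p t ω)) +
        (γ t / 2 * (m ^ 4 * cmax ^ 2 / μ t) + 2 * m * cmax * μ t) := by
      intro t ht
      have ht1 := (Finset.mem_Icc.1 ht).1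
      have hμt := hμ t ht1
      have hγt := hγ t ht1
      have h1 := (hE t ht ω).mean_excess_le (z := α t ω - shrink (μ t) (a u)) hμt hs hγt.le
        (hG t ht ω)
      have h2 : γ t / 2 * ((m * cmax) ^ 2 * ((s : ℝ) ^ 2 / μ t)) ≤
          γ t / 2 * (m ^ 4 * cmax ^ 2 / μ t) := by
        calc _ ≤ γ t / 2 * ((m * cmax) ^ 2 * ((m : ℝ) ^ 2 / μ t)) := by gcongr
          _ = _ := by ring
      -- Shrinking moves the comparator by μ_t((1/s)𝟙 - a_u), and both points cost at most m·cmax in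
      -- absolute value or from above: each coordinate of h is the cost of a spanner strategy.
      have h3 : h t ω ⬝ᵥ shrink (μ t) (a u) - h t ω ⬝ᵥ a u ≤ 2 * m * cmax * μ t := by
        have h4 : h t ω ⬝ᵥ (fun _ => (1 : ℝ) / s) ≤ m * cmax := by
          have h5 : ∀ k, h t ω k * (1 / s) ≤ m * cmax * (1 / s) := by
            intro k
            refine mul_le_mul_of_nonneg_right ?_ (by positivity)
            have := (abs_le.1 (hG t ht ω (b k))).2
            rwa [hab, dotProduct_single_one] at this
          refine (Finset.sum_le_card_nsmul _ _ _ fun k _ => h5 k).trans (le_of_eq ?_)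
          simp
          field_simp
        have h6 := (abs_le.1 (hG t ht ω u)).1
        have e2 : shrink (μ t) (a u) = a u - μ t • a u + μ t • fun _ => (1 : ℝ) / s := by
          ext k
          simp only [shrink, Pi.add_apply, Pi.sub_apply, Pi.smul_apply, smul_eq_mul]
          ring
        rw [e2, dotProduct_add, dotProduct_sub, dotProduct_smul, dotProduct_smul, smul_eq_mul,
          smul_eq_mul]
        nlinarith
      have e3 : α t ω - (α t ω - shrink (μ t) (a u)) = shrink (μ t) (a u) := by abel
      rw [e3] at h1
      rw [← hcost t ω _ (hpS t ht), ← hcost t ω _ hu]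
      have e4 : d u t ω (p t ω) = h t ω ⬝ᵥ a (p t ω) -
          gradEstimate a (q t ω) (h t ω) (p t ω) ⬝ᵥ (α t ω - shrink (μ t) (a u)) +
          γ t / 2 * (gradEstimate a (q t ω) (h t ω) (p t ω) ⬝ᵥ
            gradEstimate a (q t ω) (h t ω) (p t ω)) -
          ∑ w, q t ω w * excess a (q t ω) (h t ω) (α t ω - shrink (μ t) (a u)) (γ t) w := rfl
      rw [e4]
      linarith
    have hall := Finset.sum_le_sum hstep
    rw [Finset.sum_sub_distrib, Finset.sum_add_distrib, Finset.sum_sub_distrib,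
      Finset.sum_add_distrib] at hall
    have h7 : 4 * θ ^ 2 * (s : ℝ) / γ T ≤ 4 * θ ^ 2 * m / γ T := by
      have := hγ T hT
      gcongr
    linarith
  have hprob : 1 ≤ P.real Good + δ := by
    calc (1 : ℝ) = P.real Set.univ := by simp
      _ ≤ P.real (Good ∪ ((⋃ u ∈ S, A u) ∪ N)) := measureReal_mono hcover
      _ ≤ P.real Good + (P.real (⋃ u ∈ S, A u) + P.real N) :=
          (measureReal_union_le _ _).trans (by gcongr; exact measureReal_union_le _ _)
      _ ≤ P.real Good + ∑ u ∈ S, P.real (A u) := by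
          rw [hPN, add_zero]
          gcongr
          exact measureReal_biUnion_finset_le _ _
      _ ≤ P.real Good + δ := by
          gcongr
          refine (Finset.sum_le_sum hPA).trans ?_
          rw [Finset.sum_const, nsmul_eq_mul]
          exact card_mul_exp_le hm hδ hδ1
  linarith

end Run

/-! ### Sums of the parameters and the final order. -/

section Numeric

/-- Each increment of x^w is at least w times its derivative factor at the right endpoint, by
Bernoulli's inequality (1 - 1/(k+1))^w ≤ 1 - w/(k+1). -/
theorem sum_rpow_sub_one_le {w : ℝ} (hw0 : 0 < w) (hw1 : w ≤ 1) (T : ℕ) :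
    ∑ t ∈ Finset.Icc 1 T, (t : ℝ) ^ (w - 1) ≤ (T : ℝ) ^ w / w := by
  induction T with
  | zero => simp [Real.zero_rpow hw0.ne']
  | succ k ih =>
    rw [Finset.sum_Icc_succ_top (by omega)]
    have hk : (0 : ℝ) < (k + 1 : ℕ) := by positivity
    have h1 : ((k : ℕ) : ℝ) ^ w ≤ ((k + 1 : ℕ) : ℝ) ^ w - w * ((k + 1 : ℕ) : ℝ) ^ (w - 1) := by
      have h2 := rpow_one_add_le_one_add_mul_self (s := -(1 / ((k + 1 : ℕ) : ℝ)))
        (by rw [neg_le_neg_iff, div_le_one hk]; push_cast; linarith [k.cast_nonneg (α := ℝ)])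
        hw0.le hw1
      have e1 : (k : ℝ) = ((k + 1 : ℕ) : ℝ) * (1 + -(1 / ((k + 1 : ℕ) : ℝ))) := by
        field_simp; push_cast; ring
      have h3 : (0 : ℝ) ≤ 1 + -(1 / ((k + 1 : ℕ) : ℝ)) := by
        have : 1 / ((k + 1 : ℕ) : ℝ) ≤ 1 := by
          rw [div_le_one hk]; push_cast; linarith [k.cast_nonneg (α := ℝ)]
        linarith
      calc (k : ℝ) ^ w = ((k + 1 : ℕ) : ℝ) ^ w * (1 + -(1 / ((k + 1 : ℕ) : ℝ))) ^ w := by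
            conv_lhs => rw [e1]
            rw [Real.mul_rpow hk.le h3]
        _ ≤ ((k + 1 : ℕ) : ℝ) ^ w * (1 + w * -(1 / ((k + 1 : ℕ) : ℝ))) :=
            mul_le_mul_of_nonneg_left h2 (by positivity)
        _ = _ := by rw [Real.rpow_sub_one hk.ne']; ring
    have h4 : (k : ℝ) ^ w / w ≤
        (((k + 1 : ℕ) : ℝ) ^ w - w * ((k + 1 : ℕ) : ℝ) ^ (w - 1)) / w := by gcongr
    have e : (((k + 1 : ℕ) : ℝ) ^ w - w * ((k + 1 : ℕ) : ℝ) ^ (w - 1)) / w =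
        ((k + 1 : ℕ) : ℝ) ^ w / w - ((k + 1 : ℕ) : ℝ) ^ (w - 1) := by field_simp
    linarith

theorem rpow_eq_tenth_pow {x e : ℝ} (hx : 0 ≤ x) (k : ℕ) (he : e = k / 10) :
    x ^ e = (x ^ (1 / 10 : ℝ)) ^ k := by
  rw [← Real.rpow_natCast, ← Real.rpow_mul hx, he]
  congr 1
  ring

/-- Caps one summand by the trivial bound while leaving the others intact, so that it can be applied
to several summands in turn. -/
theorem le_min_add {r A B W : ℝ} (hB : 0 ≤ B) (h : r ≤ A + B) (hW : r ≤ W) :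
    r ≤ min A W + B := by
  rcases le_total A W with h1 | h1
  · rwa [min_eq_left h1]
  · rw [min_eq_right h1]; linarith

theorem sq_add_eight_mul_sq_le {x y : ℝ} (hx : 0 ≤ x) (hy : 0 ≤ y) :
    x ^ 2 + 8 * y ^ 2 ≤ (x + 3 * y) ^ 2 := by
  nlinarith [mul_nonneg hx hy, sq_nonneg y]

theorem min_le_of_mul_le {A W k G : ℝ} (hA : 0 ≤ A) (hW : 0 ≤ W) (hkG : 0 ≤ k * G)
    (h : A * W ≤ k ^ 2 * G ^ 2) : min A W ≤ k * G := by
  refine abs_le_of_sq_le_sq' ?_ hkG |>.2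
  calc min A W ^ 2 = min A W * min A W := sq _
    _ ≤ A * W := mul_le_mul (min_le_left _ _) (min_le_right _ _) (le_min hA hW) hA
    _ ≤ _ := by rw [mul_pow]; exact h

variable {n m T : ℕ} {θ cmax : ℝ}

/-- The ratio γ_t/μ_t is largest relative to t^{-1/2} when μ_t is smallest, that is at T; `D` is
this extreme ratio with the factor θ^{-1/2} dropped. -/
theorem stepSize_le (hθ : 1 ≤ θ) (hn : 1 ≤ n) (hm : 1 ≤ m) (hc : 0 < cmax) {D : ℝ} (hD : 0 ≤ D)
    (hD2 : D ^ 2 * (n ^ 3 * m ^ 6 * bias n m cmax T) = cmax) {t : ℕ} (ht : t ∈ Finset.Icc 1 T) :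
    stepSize θ n m cmax t ≤ D * bias n m cmax t * (t : ℝ) ^ (-(1 / 2) : ℝ) := by
  obtain ⟨ht1, htT⟩ := Finset.mem_Icc.1 ht
  have hn' : (0 : ℝ) < n := by exact_mod_cast hn
  have hm' : (0 : ℝ) < m := by exact_mod_cast hm
  have ht' : (0 : ℝ) < t := by exact_mod_cast ht1
  have hμt := bias_pos hn hm hc ht1
  have hμT := bias_pos hn hm hc (ht1.trans htT)
  have hle := bias_anti (n := n) hm hc ht1 htT
  refine Real.sqrt_le_iff.2 ⟨by positivity, ?_⟩
  have e : ((t : ℝ) ^ (-(1 / 2) : ℝ)) ^ 2 = (t : ℝ)⁻¹ := by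
    rw [← Real.rpow_natCast, ← Real.rpow_mul ht'.le, ← Real.rpow_neg_one]
    norm_num
  rw [mul_pow, mul_pow, e, div_le_iff₀ (by positivity)]
  calc cmax * bias n m cmax t
      = D ^ 2 * n ^ 3 * m ^ 6 * bias n m cmax t * bias n m cmax T := by
        nth_rewrite 1 [← hD2]; ring
    _ ≤ D ^ 2 * n ^ 3 * m ^ 6 * bias n m cmax t * bias n m cmax t := by gcongr
    _ ≤ D ^ 2 * n ^ 3 * m ^ 6 * bias n m cmax t * bias n m cmax t * θ :=
        le_mul_of_one_le_right (by positivity) hθ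
    _ = _ := by field_simp

theorem sum_stepSize_div_bias_le (hθ : 1 ≤ θ) (hn : 1 ≤ n) (hm : 1 ≤ m) (hc : 0 < cmax) {D : ℝ}
    (hD : 0 ≤ D) (hD2 : D ^ 2 * (n ^ 3 * m ^ 6 * bias n m cmax T) = cmax) :
    ∑ t ∈ Finset.Icc 1 T, stepSize θ n m cmax t / 2 * (m ^ 4 * cmax ^ 2 / bias n m cmax t) ≤
      m ^ 4 * cmax ^ 2 * D * (T : ℝ) ^ (1 / 2 : ℝ) := by
  have h1 := sum_rpow_sub_one_le (w := 1 / 2) (by norm_num) (by norm_num) T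
  norm_num only at h1
  calc _ ≤ ∑ t ∈ Finset.Icc 1 T, m ^ 4 * cmax ^ 2 * D / 2 * (t : ℝ) ^ (-(1 / 2) : ℝ) := by
        refine Finset.sum_le_sum fun t ht => ?_
        have hμt := bias_pos hn hm hc (Finset.mem_Icc.1 ht).1
        have h2 := stepSize_le hθ hn hm hc hD hD2 ht
        calc _ ≤ D * bias n m cmax t * (t : ℝ) ^ (-(1 / 2) : ℝ) / 2 *
              (m ^ 4 * cmax ^ 2 / bias n m cmax t) := by gcongr
          _ = _ := by field_simp
    _ ≤ m ^ 4 * cmax ^ 2 * D / 2 * ((T : ℝ) ^ (1 / 2 : ℝ) / (1 / 2)) := by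
        rw [← Finset.mul_sum]
        gcongr
    _ = _ := by ring

theorem sum_sq_deviation_le (hθ : 1 ≤ θ) (hn : 1 ≤ n) (hm : 1 ≤ m) (hc : 0 < cmax) {D : ℝ}
    (hD : 0 ≤ D) (hD2 : D ^ 2 * (n ^ 3 * m ^ 6 * bias n m cmax T) = cmax) :
    ∑ t ∈ Finset.Icc 1 T, deviation θ n m cmax t ^ 2 ≤
      2 * T * (6 * θ ^ 2 * m ^ 3 * cmax / bias n m cmax T) ^ 2 +
      4 * (D * θ ^ 2 * m ^ 5 * cmax ^ 2 / bias n m cmax T) ^ 2 * (T : ℝ) ^ (1 / 2 : ℝ) := by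
  have h1 := sum_rpow_sub_one_le (w := 1 / 2) (by norm_num) (by norm_num) T
  norm_num only at h1
  set X := 6 * θ ^ 2 * m ^ 3 * cmax / bias n m cmax T
  set E := D * θ ^ 2 * m ^ 5 * cmax ^ 2 / bias n m cmax T
  calc _ ≤ ∑ t ∈ Finset.Icc 1 T, (2 * X ^ 2 + 2 * E ^ 2 * (t : ℝ) ^ (-(1 / 2) : ℝ)) := by
        refine Finset.sum_le_sum fun t ht => ?_
        obtain ⟨ht1, htT⟩ := Finset.mem_Icc.1 ht
        have ht' : (1 : ℝ) ≤ t := by exact_mod_cast ht1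
        have hμt := bias_pos hn hm hc ht1
        have hμT := bias_pos hn hm hc (ht1.trans htT)
        have hle := bias_anti (n := n) hm hc ht1 htT
        have hγ := stepSize_pos hθ hn hm hc ht1
        have h2 := stepSize_le hθ hn hm hc hD hD2 ht
        have hx : 6 * θ ^ 2 * m ^ 3 * cmax / bias n m cmax t ≤ X := by
          simp only [X]; gcongr
        have hy : stepSize θ n m cmax t * θ ^ 2 * m ^ 5 * cmax ^ 2 / bias n m cmax t ^ 2 ≤
            E * (t : ℝ) ^ (-(1 / 2) : ℝ) := by
          calc _ ≤ D * bias n m cmax t * (t : ℝ) ^ (-(1 / 2) : ℝ) * θ ^ 2 * m ^ 5 * cmax ^ 2 /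
                bias n m cmax t ^ 2 := by gcongr
            _ = D * θ ^ 2 * m ^ 5 * cmax ^ 2 / bias n m cmax t * (t : ℝ) ^ (-(1 / 2) : ℝ) := by
                field_simp
            _ ≤ _ := by simp only [E]; gcongr
        have hr0 : 0 ≤ (t : ℝ) ^ (-(1 / 2) : ℝ) := by positivity
        have hr1 : (t : ℝ) ^ (-(1 / 2) : ℝ) ≤ 1 :=
          Real.rpow_le_one_of_one_le_of_nonpos ht' (by norm_num)
        have hx2 := pow_le_pow_left₀ (by positivity) hx 2
        have hy2 := pow_le_pow_left₀ (by positivity) hy 2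
        -- Replacing 1/t by t^{-1/2} is lossy but avoids the logarithm of the harmonic sum.
        have hr2 : E ^ 2 * ((t : ℝ) ^ (-(1 / 2) : ℝ)) ^ 2 ≤ E ^ 2 * (t : ℝ) ^ (-(1 / 2) : ℝ) :=
          mul_le_mul_of_nonneg_left (by nlinarith) (sq_nonneg _)
        rw [deviation]
        rw [mul_pow E] at hy2
        refine (add_sq_le).trans ?_
        linarith
    _ = 2 * T * X ^ 2 + 2 * E ^ 2 * ∑ t ∈ Finset.Icc 1 T, (t : ℝ) ^ (-(1 / 2) : ℝ) := by
        rw [Finset.sum_add_distrib, Finset.sum_const, ← Finset.mul_sum, Nat.card_Icc,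
          add_tsub_cancel_right, nsmul_eq_mul]
        ring
    _ ≤ 2 * T * X ^ 2 + 2 * E ^ 2 * ((T : ℝ) ^ (1 / 2 : ℝ) / (1 / 2)) := by gcongr
    _ = _ := by ring

theorem sum_bias_le (n m : ℕ) (hm : 1 ≤ m) (hc : 0 < cmax) (T : ℕ) :
    ∑ t ∈ Finset.Icc 1 T, 2 * m * cmax * bias n m cmax t ≤
      5 / 2 * m * cmax * ((n : ℝ) ^ (1 / 5 : ℝ) /
        ((m : ℝ) ^ (7 / 5 : ℝ) * cmax ^ (1 / 5 : ℝ))) * (T : ℝ) ^ (4 / 5 : ℝ) := by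
  have hm' : (0 : ℝ) < m := by exact_mod_cast hm
  have h1 := sum_rpow_sub_one_le (w := 4 / 5) (by norm_num) (by norm_num) T
  norm_num only at h1
  set F := (n : ℝ) ^ (1 / 5 : ℝ) / ((m : ℝ) ^ (7 / 5 : ℝ) * cmax ^ (1 / 5 : ℝ)) with hF
  have hF0 : 0 ≤ F := by positivity
  calc _ ≤ ∑ t ∈ Finset.Icc 1 T, 2 * m * cmax * F * (t : ℝ) ^ (-(1 / 5) : ℝ) := by
        refine Finset.sum_le_sum fun t ht => ?_
        have ht' : (0 : ℝ) < t := by exact_mod_cast (Finset.mem_Icc.1 ht).1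
        rw [mul_assoc (2 * m * cmax)]
        refine mul_le_mul_of_nonneg_left ((min_le_left _ _).trans (le_of_eq ?_)) (by positivity)
        rw [Real.rpow_neg ht'.le, hF]
        field_simp
    _ ≤ 2 * m * cmax * F * ((T : ℝ) ^ (4 / 5 : ℝ) / (4 / 5)) := by
        rw [← Finset.mul_sum]
        gcongr
    _ = _ := by ring

set_option maxHeartbeats 1000000 in
/-- The regret bound of the algorithm, combined with the trivial bound, has the claimed order. -/
theorem le_of_le_regret_bound (hθ : 1 ≤ θ) (hn : 1 ≤ n) (hm : 1 ≤ m) (hT : 1 ≤ T)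
    (hc : 0 < cmax) {l r : ℝ} (hl : 1 ≤ l) (hr0 : r ≤ 2 * m * cmax * T)
    (hr : r ≤ 4 * θ ^ 2 * m / stepSize θ n m cmax T +
      ∑ t ∈ Finset.Icc 1 T, (stepSize θ n m cmax t / 2 * (m ^ 4 * cmax ^ 2 / bias n m cmax t) +
        2 * m * cmax * bias n m cmax t) +
      Real.sqrt (2 * (∑ t ∈ Finset.Icc 1 T, deviation θ n m cmax t ^ 2) * (m * l))) :
    r ≤ 300 * θ ^ 2 * (n : ℝ) ^ (7 / 10 : ℝ) * (m : ℝ) ^ (11 / 2 : ℝ) * max 1 cmax ^ 2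
      * (T : ℝ) ^ (4 / 5 : ℝ) * Real.sqrt l := by
  have hnR : (1 : ℝ) ≤ n := by exact_mod_cast hn
  have hmR : (1 : ℝ) ≤ m := by exact_mod_cast hm
  have hTR : (1 : ℝ) ≤ T := by exact_mod_cast hT
  -- All exponents are multiples of 1/10; in tenth roots every term is a monomial with integer
  -- exponents.
  obtain ⟨N, hN⟩ : ∃ N, N = (n : ℝ) ^ (1 / 10 : ℝ) := ⟨_, rfl⟩
  obtain ⟨M, hM⟩ : ∃ M, M = (m : ℝ) ^ (1 / 10 : ℝ) := ⟨_, rfl⟩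
  obtain ⟨τ, hτ⟩ : ∃ τ, τ = (T : ℝ) ^ (1 / 10 : ℝ) := ⟨_, rfl⟩
  obtain ⟨C, hC⟩ : ∃ C, C = cmax ^ (1 / 10 : ℝ) := ⟨_, rfl⟩
  obtain ⟨Λ, hΛ⟩ : ∃ Λ, Λ = Real.sqrt l := ⟨_, rfl⟩
  have hN1 : 1 ≤ N := hN ▸ Real.one_le_rpow hnR (by norm_num)
  have hM1 : 1 ≤ M := hM ▸ Real.one_le_rpow hmR (by norm_num)
  have hτ1 : 1 ≤ τ := hτ ▸ Real.one_le_rpow hTR (by norm_num)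
  have hC0 : 0 < C := hC ▸ Real.rpow_pos_of_pos hc _
  have hΛ1 : 1 ≤ Λ := hΛ ▸ Real.one_le_sqrt.2 hl
  have hN0 : 0 < N := by linarith
  have hM0 : 0 < M := by linarith
  have hτ0 : 0 < τ := by linarith
  have hn10 : (n : ℝ) = N ^ 10 := by
    rw [hN, ← rpow_eq_tenth_pow (by linarith) 10 (e := 1) (by norm_num), Real.rpow_one]
  have hm10 : (m : ℝ) = M ^ 10 := by
    rw [hM, ← rpow_eq_tenth_pow (by linarith) 10 (e := 1) (by norm_num), Real.rpow_one]
  have hT10 : (T : ℝ) = τ ^ 10 := by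
    rw [hτ, ← rpow_eq_tenth_pow (by linarith) 10 (e := 1) (by norm_num), Real.rpow_one]
  have hc10 : cmax = C ^ 10 := by
    rw [hC, ← rpow_eq_tenth_pow hc.le 10 (e := 1) (by norm_num), Real.rpow_one]
  have hl2 : l = Λ ^ 2 := by rw [hΛ, Real.sq_sqrt (by linarith)]
  have en2 : (n : ℝ) ^ (1 / 5 : ℝ) = N ^ 2 := by
    rw [hN]; exact rpow_eq_tenth_pow (by linarith) 2 (by norm_num)
  have en7 : (n : ℝ) ^ (7 / 10 : ℝ) = N ^ 7 := by
    rw [hN]; exact rpow_eq_tenth_pow (by linarith) 7 (by norm_num)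
  have em14 : (m : ℝ) ^ (7 / 5 : ℝ) = M ^ 14 := by
    rw [hM]; exact rpow_eq_tenth_pow (by linarith) 14 (by norm_num)
  have em55 : (m : ℝ) ^ (11 / 2 : ℝ) = M ^ 55 := by
    rw [hM]; exact rpow_eq_tenth_pow (by linarith) 55 (by norm_num)
  have eT2 : (T : ℝ) ^ (1 / 5 : ℝ) = τ ^ 2 := by
    rw [hτ]; exact rpow_eq_tenth_pow (by linarith) 2 (by norm_num)
  have eT5 : (T : ℝ) ^ (1 / 2 : ℝ) = τ ^ 5 := by
    rw [hτ]; exact rpow_eq_tenth_pow (by linarith) 5 (by norm_num)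
  have eT8 : (T : ℝ) ^ (4 / 5 : ℝ) = τ ^ 8 := by
    rw [hτ]; exact rpow_eq_tenth_pow (by linarith) 8 (by norm_num)
  have ec2 : cmax ^ (1 / 5 : ℝ) = C ^ 2 := by
    rw [hC]; exact rpow_eq_tenth_pow hc.le 2 (by norm_num)
  obtain ⟨X, hX⟩ : ∃ X, X = max 1 C := ⟨_, rfl⟩
  have hX1 : 1 ≤ X := hX ▸ le_max_left _ _
  have hCX : C ≤ X := hX ▸ le_max_right _ _
  have emax : max 1 cmax = X ^ 10 := by
    rw [hX, hc10]
    rcases le_total 1 C with h | h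
    · rw [max_eq_right h, max_eq_right (one_le_pow₀ h)]
    · rw [max_eq_left h, max_eq_left (pow_le_one₀ hC0.le h), one_pow]
  have hCp : ∀ i j : ℕ, i ≤ j → C ^ i ≤ X ^ j := fun i j hij =>
    (pow_le_pow_left₀ hC0.le hCX i).trans (pow_le_pow_right₀ hX1 hij)
  have hNp : ∀ i j : ℕ, i ≤ j → N ^ i ≤ N ^ j := fun i j hij => pow_le_pow_right₀ hN1 hij
  have hMp : ∀ i j : ℕ, i ≤ j → M ^ i ≤ M ^ j := fun i j hij => pow_le_pow_right₀ hM1 hij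
  have hτp : ∀ i j : ℕ, i ≤ j → τ ^ i ≤ τ ^ j := fun i j hij => pow_le_pow_right₀ hτ1 hij
  have hΛp : ∀ i j : ℕ, i ≤ j → Λ ^ i ≤ Λ ^ j := fun i j hij => pow_le_pow_right₀ hΛ1 hij
  have hX0 : 0 < X := by linarith
  have hΛ0 : 0 < Λ := by linarith
  have mono : ∀ {i₁ i₂ i₃ i₄ i₅ j₁ j₂ j₃ j₄ j₅ : ℕ}, i₁ ≤ j₁ → i₂ ≤ j₂ → i₃ ≤ j₃ → i₄ ≤ j₄ →
      i₅ ≤ j₅ → N ^ i₁ * M ^ i₂ * C ^ i₃ * τ ^ i₄ * Λ ^ i₅ ≤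
        N ^ j₁ * M ^ j₂ * X ^ j₃ * τ ^ j₄ * Λ ^ j₅ := by
    intro i₁ i₂ i₃ i₄ i₅ j₁ j₂ j₃ j₄ j₅ h₁ h₂ h₃ h₄ h₅
    have := hNp _ _ h₁
    have := hMp _ _ h₂
    have := hCp _ _ h₃
    have := hτp _ _ h₄
    have := hΛp _ _ h₅
    gcongr
  obtain ⟨G, hG⟩ : ∃ G, G = N ^ 7 * M ^ 55 * X ^ 20 * τ ^ 8 * Λ ^ 1 := ⟨_, rfl⟩
  have hG0 : 0 < G := by rw [hG]; positivity
  have hG2 : G ^ 2 = N ^ 14 * M ^ 110 * X ^ 40 * τ ^ 16 * Λ ^ 2 := by rw [hG]; ring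
  have hθ2 : 1 ≤ θ ^ 2 := one_le_pow₀ hθ
  have hgoal : 300 * θ ^ 2 * (n : ℝ) ^ (7 / 10 : ℝ) * (m : ℝ) ^ (11 / 2 : ℝ) * max 1 cmax ^ 2
      * (T : ℝ) ^ (4 / 5 : ℝ) * Real.sqrt l = 300 * θ ^ 2 * G := by
    rw [en7, em55, emax, eT8, ← hΛ, hG]; ring
  rw [hgoal]
  have hW : r ≤ 2 * M ^ 10 * C ^ 10 * τ ^ 10 := by
    rw [← hm10, ← hc10, ← hT10]; exact hr0
  rcases le_total (1 / 2) (N ^ 2 / (M ^ 14 * τ ^ 2 * C ^ 2)) with hcap | hcap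
  · have h1 : M ^ 7 * τ * C ≤ 2 * N := by
      refine abs_le_of_sq_le_sq' ?_ (by positivity) |>.2
      rw [div_le_div_iff₀ (by norm_num) (by positivity)] at hcap
      calc (M ^ 7 * τ * C) ^ 2 = 1 * (M ^ 14 * τ ^ 2 * C ^ 2) := by ring
        _ ≤ N ^ 2 * 2 := hcap
        _ ≤ (2 * N) ^ 2 := by linarith [sq_nonneg N]
    have h2 := pow_le_pow_left₀ (by positivity) h1 7
    have h3 : M ^ 10 ≤ M ^ 49 := hMp _ _ (by norm_num)
    have h4 := mono (i₁ := 7) (j₁ := 7) (i₂ := 0) (j₂ := 55) (i₃ := 3) (j₃ := 20) (i₄ := 3)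
      (j₄ := 8) (i₅ := 0) (j₅ := 1) le_rfl (by norm_num) (by norm_num) (by norm_num) (by norm_num)
    rw [← hG] at h4
    calc r ≤ 2 * M ^ 10 * C ^ 10 * τ ^ 10 := hW
      _ ≤ 2 * M ^ 49 * C ^ 10 * τ ^ 10 := by gcongr
      _ = 2 * C ^ 3 * τ ^ 3 * (M ^ 7 * τ * C) ^ 7 := by ring
      _ ≤ 2 * C ^ 3 * τ ^ 3 * (2 * N) ^ 7 := by gcongr
      _ = 256 * (N ^ 7 * M ^ 0 * C ^ 3 * τ ^ 3 * Λ ^ 0) := by ring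
      _ ≤ 256 * G := by gcongr
      -- The constant 256 = 2·2^7 of this capped regime, where T is small enough for the trivial
      -- bound, is what forces 300.
      _ ≤ 300 * θ ^ 2 * G := by gcongr; linarith
  have hμ : bias n m cmax T = N ^ 2 / (M ^ 14 * τ ^ 2 * C ^ 2) := by
    rw [bias, en2, em14, eT2, ec2, min_eq_left hcap]
  have hD0 : 0 ≤ C ^ 6 * τ / (N ^ 16 * M ^ 23) := by positivity
  have hD2 : (C ^ 6 * τ / (N ^ 16 * M ^ 23)) ^ 2 * (n ^ 3 * m ^ 6 * bias n m cmax T) = cmax := by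
    rw [hμ, hn10, hm10, hc10]; field_simp
  have hγ : C ^ 4 / (θ * N ^ 14 * M ^ 37 * τ ^ 6) ≤ stepSize θ n m cmax T := by
    refine Real.le_sqrt_of_sq_le ?_
    have e : cmax * bias n m cmax T / (θ * n ^ 3 * m ^ 6 * T) =
        C ^ 8 / (θ * (N ^ 28 * M ^ 74 * τ ^ 12)) := by
      rw [hμ, hn10, hm10, hc10, hT10]; field_simp
    rw [e, div_pow]
    rw [show (C ^ 4) ^ 2 = C ^ 8 by ring,
      show (θ * N ^ 14 * M ^ 37 * τ ^ 6) ^ 2 = θ * (θ * (N ^ 28 * M ^ 74 * τ ^ 12)) by ring]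
    have : 0 < θ := by linarith
    exact div_le_div_of_nonneg_left (by positivity) (by positivity)
      (le_mul_of_one_le_left (by positivity) hθ)
  have hA1 : 4 * θ ^ 2 * m / stepSize θ n m cmax T ≤
      4 * θ ^ 3 * N ^ 14 * M ^ 47 * τ ^ 6 / C ^ 4 := by
    have : 0 < θ := by linarith
    calc _ ≤ 4 * θ ^ 2 * m / (C ^ 4 / (θ * N ^ 14 * M ^ 37 * τ ^ 6)) := by gcongr
      _ = _ := by rw [hm10]; field_simp
  have hA2 := sum_stepSize_div_bias_le hθ hn hm hc hD0 hD2
  have eA2 : m ^ 4 * cmax ^ 2 * (C ^ 6 * τ / (N ^ 16 * M ^ 23)) * (T : ℝ) ^ (1 / 2 : ℝ) =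
      C ^ 26 * M ^ 17 * τ ^ 6 / N ^ 16 := by
    rw [hm10, hc10, eT5]; field_simp
  rw [eA2] at hA2
  have hA3 := sum_bias_le n m hm hc T
  have hA3' : 5 / 2 * m * cmax * ((n : ℝ) ^ (1 / 5 : ℝ) /
      ((m : ℝ) ^ (7 / 5 : ℝ) * cmax ^ (1 / 5 : ℝ))) * (T : ℝ) ^ (4 / 5 : ℝ) ≤ 5 / 2 * G := by
    have h4 := mono (i₁ := 2) (j₁ := 7) (i₂ := 0) (j₂ := 55) (i₃ := 8) (j₃ := 20) (i₄ := 8)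
      (j₄ := 8) (i₅ := 0) (j₅ := 1) (by norm_num) (by norm_num) (by norm_num) (by norm_num)
      (by norm_num)
    rw [← hG] at h4
    calc _ = 5 / 2 * (N ^ 2 * C ^ 8 * τ ^ 8) / M ^ 4 := by
          rw [en2, em14, ec2, eT8, hm10, hc10]; field_simp
      _ ≤ 5 / 2 * (N ^ 2 * C ^ 8 * τ ^ 8) := div_le_self (by positivity) (one_le_pow₀ hM1)
      _ = 5 / 2 * (N ^ 2 * M ^ 0 * C ^ 8 * τ ^ 8 * Λ ^ 0) := by ring
      _ ≤ _ := by gcongr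
  have hV := sum_sq_deviation_le hθ hn hm hc hD0 hD2
  have eV : 2 * T * (6 * θ ^ 2 * m ^ 3 * cmax / bias n m cmax T) ^ 2 +
      4 * (C ^ 6 * τ / (N ^ 16 * M ^ 23) * θ ^ 2 * m ^ 5 * cmax ^ 2 / bias n m cmax T) ^ 2 *
        (T : ℝ) ^ (1 / 2 : ℝ) =
      72 * θ ^ 4 * M ^ 88 * C ^ 24 * τ ^ 14 / N ^ 4 +
        4 * θ ^ 4 * M ^ 82 * C ^ 56 * τ ^ 11 / N ^ 36 := by
    rw [hμ, hm10, hc10, eT5, hT10]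
    congr 1
    · field_simp; norm_num
    · field_simp
  rw [eV] at hV
  have hA4 : Real.sqrt (2 * (∑ t ∈ Finset.Icc 1 T, deviation θ n m cmax t ^ 2) * (m * l)) ≤
      12 * θ ^ 2 * M ^ 49 * C ^ 12 * τ ^ 7 * Λ / N ^ 2 +
        3 * θ ^ 2 * M ^ 46 * C ^ 28 * τ ^ 6 * Λ / N ^ 18 := by
    refine Real.sqrt_le_iff.2 ⟨by positivity, ?_⟩
    -- Rounding up to an even power makes the square root a monomial.
    have h11 : τ ^ 11 ≤ τ ^ 12 := hτp _ _ (by norm_num)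
    calc _ ≤ 2 * (72 * θ ^ 4 * M ^ 88 * C ^ 24 * τ ^ 14 / N ^ 4 +
          4 * θ ^ 4 * M ^ 82 * C ^ 56 * τ ^ 12 / N ^ 36) * (M ^ 10 * Λ ^ 2) := by
          rw [← hm10, ← hl2]
          gcongr
          refine hV.trans ?_
          gcongr
      _ = (12 * θ ^ 2 * M ^ 49 * C ^ 12 * τ ^ 7 * Λ / N ^ 2) ^ 2 +
          8 * (θ ^ 2 * M ^ 46 * C ^ 28 * τ ^ 6 * Λ / N ^ 18) ^ 2 := by
          rw [div_pow, div_pow]; ring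
      _ ≤ _ := by
          have h1 : 0 ≤ 12 * θ ^ 2 * M ^ 49 * C ^ 12 * τ ^ 7 * Λ / N ^ 2 := by positivity
          have h2 : 0 ≤ θ ^ 2 * M ^ 46 * C ^ 28 * τ ^ 6 * Λ / N ^ 18 := by positivity
          refine (sq_add_eight_mul_sq_le h1 h2).trans (le_of_eq ?_)
          ring
  have hA5 : 12 * θ ^ 2 * M ^ 49 * C ^ 12 * τ ^ 7 * Λ / N ^ 2 ≤ 12 * θ ^ 2 * G := by
    have h4 := mono (i₁ := 0) (j₁ := 7) (i₂ := 49) (j₂ := 55) (i₃ := 12) (j₃ := 20) (i₄ := 7)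
      (j₄ := 8) (i₅ := 1) (j₅ := 1) (by norm_num) (by norm_num) (by norm_num) (by norm_num)
      (by norm_num)
    rw [← hG] at h4
    calc _ ≤ 12 * θ ^ 2 * M ^ 49 * C ^ 12 * τ ^ 7 * Λ :=
          div_le_self (by positivity) (one_le_pow₀ hN1)
      _ = 12 * θ ^ 2 * (N ^ 0 * M ^ 49 * C ^ 12 * τ ^ 7 * Λ ^ 1) := by ring
      _ ≤ _ := by gcongr
  have hW0 : 0 ≤ 2 * M ^ 10 * C ^ 10 * τ ^ 10 := by positivity
  have hθ0 : 0 < θ := by linarith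
  -- The geometric mean with the trivial bound turns n^{7/5} T^{3/5} into n^{7/10} T^{4/5} and
  -- removes the negative power of cmax; this is the source of the exponent 7/10.
  have hm1 : min (4 * θ ^ 3 * N ^ 14 * M ^ 47 * τ ^ 6 / C ^ 4) (2 * M ^ 10 * C ^ 10 * τ ^ 10) ≤
      3 * θ ^ 2 * G := by
    refine min_le_of_mul_le (by positivity) hW0 (by positivity) ?_
    have h4 := mono (i₁ := 14) (j₁ := 14) (i₂ := 57) (j₂ := 110) (i₃ := 6) (j₃ := 40) (i₄ := 16)
      (j₄ := 16) (i₅ := 0) (j₅ := 2) (by norm_num) (by norm_num) (by norm_num) (by norm_num)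
      (by norm_num)
    rw [← hG2] at h4
    calc _ = 8 * θ ^ 3 * (N ^ 14 * M ^ 57 * C ^ 6 * τ ^ 16 * Λ ^ 0) := by field_simp; norm_num
      _ ≤ 9 * θ ^ 4 * G ^ 2 := by
          have : θ ^ 3 ≤ θ ^ 4 := pow_le_pow_right₀ hθ (by norm_num)
          gcongr
          norm_num
      _ = _ := by ring
  have hm2 : min (C ^ 26 * M ^ 17 * τ ^ 6 / N ^ 16) (2 * M ^ 10 * C ^ 10 * τ ^ 10) ≤ 2 * G := by
    refine min_le_of_mul_le (by positivity) hW0 (by positivity) ?_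
    have h4 := mono (i₁ := 0) (j₁ := 14) (i₂ := 27) (j₂ := 110) (i₃ := 36) (j₃ := 40) (i₄ := 16)
      (j₄ := 16) (i₅ := 0) (j₅ := 2) (by norm_num) (by norm_num) (by norm_num) (by norm_num)
      (by norm_num)
    rw [← hG2] at h4
    calc _ = 2 * (C ^ 36 * M ^ 27 * τ ^ 16) / N ^ 16 := by ring
      _ ≤ 2 * (C ^ 36 * M ^ 27 * τ ^ 16) := div_le_self (by positivity) (one_le_pow₀ hN1)
      _ = 2 * (N ^ 0 * M ^ 27 * C ^ 36 * τ ^ 16 * Λ ^ 0) := by ring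
      _ ≤ 2 ^ 2 * G ^ 2 := by gcongr; norm_num
  have hm6 : min (3 * θ ^ 2 * M ^ 46 * C ^ 28 * τ ^ 6 * Λ / N ^ 18)
      (2 * M ^ 10 * C ^ 10 * τ ^ 10) ≤ 3 * θ ^ 2 * G := by
    refine min_le_of_mul_le (by positivity) hW0 (by positivity) ?_
    have h4 := mono (i₁ := 0) (j₁ := 14) (i₂ := 56) (j₂ := 110) (i₃ := 38) (j₃ := 40) (i₄ := 16)
      (j₄ := 16) (i₅ := 1) (j₅ := 2) (by norm_num) (by norm_num) (by norm_num) (by norm_num)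
      (by norm_num)
    rw [← hG2] at h4
    calc _ = 6 * θ ^ 2 * (M ^ 56 * C ^ 38 * τ ^ 16 * Λ) / N ^ 18 := by ring
      _ ≤ 6 * θ ^ 2 * (M ^ 56 * C ^ 38 * τ ^ 16 * Λ) :=
          div_le_self (by positivity) (one_le_pow₀ hN1)
      _ = 6 * θ ^ 2 * (N ^ 0 * M ^ 56 * C ^ 38 * τ ^ 16 * Λ ^ 1) := by ring
      _ ≤ 9 * θ ^ 4 * G ^ 2 := by
          have : θ ^ 2 ≤ θ ^ 4 := pow_le_pow_right₀ hθ (by norm_num)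
          gcongr
          norm_num
      _ = _ := by ring
  rw [Finset.sum_add_distrib] at hr
  have h1 : r ≤ 4 * θ ^ 3 * N ^ 14 * M ^ 47 * τ ^ 6 / C ^ 4 +
      (C ^ 26 * M ^ 17 * τ ^ 6 / N ^ 16 +
        (3 * θ ^ 2 * M ^ 46 * C ^ 28 * τ ^ 6 * Λ / N ^ 18 +
          (5 / 2 * G + 12 * θ ^ 2 * G))) := by linarith
  -- The three oversized summands are rotated to the front and capped one after another.
  have h2 := le_min_add (by positivity) h1 hW
  rw [add_left_comm] at h2
  have h3 := le_min_add (add_nonneg (le_min (by positivity) hW0) (by positivity)) h2 hW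
  rw [add_left_comm (min _ _), add_left_comm (min _ _)] at h3
  have h5 := le_min_add (add_nonneg (le_min (by positivity) hW0)
    (add_nonneg (le_min (by positivity) hW0) (by positivity))) (r := r)
    (A := 3 * θ ^ 2 * M ^ 46 * C ^ 28 * τ ^ 6 * Λ / N ^ 18)
    (B := min (4 * θ ^ 3 * N ^ 14 * M ^ 47 * τ ^ 6 / C ^ 4) (2 * M ^ 10 * C ^ 10 * τ ^ 10) +
      (min (C ^ 26 * M ^ 17 * τ ^ 6 / N ^ 16) (2 * M ^ 10 * C ^ 10 * τ ^ 10) +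
        (5 / 2 * G + 12 * θ ^ 2 * G))) (by linarith) hW
  have h6 : 1 * G ≤ θ ^ 2 * G := by gcongr
  linarith

end Numeric
end BGDCE

theorem theorem1 (θ : ℝ) (hθ : 1 ≤ θ) :
    ∃ (K : ℝ) (r : ℕ), 0 < K ∧
      ∀ (n m s T : ℕ) (S : Finset (Finset (Fin m))) (hS : S.Nonempty)
        (b : Fin s → Finset (Fin m)) (cmax δ : ℝ),
        1 ≤ n → 1 ≤ T → (∃ u ∈ S, u.Nonempty) → BGDCE.IsSpanner S θ b →
        0 < cmax → 0 < δ → δ < 1 →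
        ∀ (Ω : Type*) (mΩ : MeasurableSpace Ω) (P : Measure Ω) (_ : IsProbabilityMeasure P)
          (ℱ : Filtration ℕ mΩ)
          (c : ℕ → Ω → Fin m → ℝ) (α : ℕ → Ω → Fin s → ℝ)
          (q : ℕ → Ω → Finset (Fin m) → ℝ) (p : ℕ → Ω → Finset (Fin m)),
          BGDCE.IsRun P ℱ S θ b n cmax T c α q p →
          1 - δ ≤ P.real {ω |
            BGDCE.regret S hS T (fun t => c t ω) (fun t => p t ω) ≤
              K * (n : ℝ) ^ (7 / 10 : ℝ) * (m : ℝ) ^ (11 / 2 : ℝ) * max 1 cmax ^ 2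
                * (T : ℝ) ^ (4 / 5 : ℝ) * (1 + Real.log T) ^ r
                * Real.sqrt (1 + Real.log (1 / δ))} := by
  refine ⟨300 * θ ^ 2, 0, by positivity, ?_⟩
  intro n m s T S hS b cmax δ hn hT hne hb hc hδ hδ1 Ω mΩ P _ ℱ c α q p hrun
  have hm : 1 ≤ m := (hb.card_pos hne).trans_le hb.card_le
  have hlog : 0 ≤ Real.log (1 / δ) := Real.log_nonneg (by rw [le_div_iff₀ hδ]; linarith)
  refine (hrun.regret_high_probability hS hθ hn hT hne hb hc hδ hδ1).trans
    (measureReal_mono fun ω hω => ?_)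
  have h := BGDCE.le_of_le_regret_bound hθ hn hm hT hc (l := 1 + Real.log (1 / δ))
    (by linarith) (hrun.regret_le hS hc ω) hω
  simpa using h
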